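/- Let $n\ge 0$ and let $f:[0,1)\to\mathbb R$ be Lebesgue measurable with $\int_0^{t_0}|f(s)|\,ds<\infty$ for every $t_0\in(0,1)$ and $\lim_{t\uparrow1}\int_0^t f(s)\,ds=\infty$. Put $G_f(s,t)=f(s)\,e^{-\int_s^t f(r)\,dr}$ for $s,t\in[0,1)$. **Definitions.** A function $G:[0,1)\times[0,1)\to[0,\infty)$, with $G(\cdot,t)$ integrable on $[0,t]$ for every $t\in[0,1)$, is an *approximation to the identity* if (1) $\lim_{t\uparrow1}\int_0^tG(s,t)\,ds=1$, and (2) $\lim_{t\uparrow1}\int_0^{t_0}G(s,t)\,ds=0$ for every $t_0\in[0,1)$. For $b\in\mathbb R^n$, a process $(z_t)_{0\le t<1}$ in $\mathbb R^n$ is a *Markov process with infinitesimal generator* $L_t=\frac12\Delta-f(t)\nabla\big(\tfrac{r^2(\cdot,b)}2\big)$ (where $r$ is the Euclidean distance, and the vector field $\nabla(r^2(\cdot,b)/2)$ acts by differentiation) if, for its own filtration, it is Markov with respect to a family of Markov transition kernels $(P_{s,t})_{0\le s\le t<1}$ with $P_{s,s}=\mathrm{Id}$ that satisfies the Chapman–Kolmogorov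 equations and is such that for all $\varphi\in C_c^\infty(\mathbb R^n)$: $P_{s,t}\varphi=\varphi+\int_s^tP_{s,r}L_r\varphi\,dr$ for all $0\le s\le t<1$, and $\frac1h(P_{s,s+h}\varphi-\varphi)\to L_s\varphi$ uniformly on $\mathbb R^n$ as $h\downarrow0$ for each $s\in[0,1)$ at which $f$ is right continuous. A *generalised Brownian bridge from $a$ to $b$ with terminal time $1$* is a process $(z_t)_{0\le t\le1}$ in $\mathbb R^n$ with almost surely continuous paths on $[0,1]$ and $z_0=a$ a.s., such that (i) $(z_t)_{0\le t<1}$ is a Markov process with infinitesimal generator $\frac12\Delta-g(t)\nabla\big(\tfrac{r^2(\cdot,b)}2\big)$ for some real function $g$ on $[0,1)$, integrable on $[0,t_0]$ for every $t_0<1$, with (i') $\lim_{t\uparrow1}g(t)=\infty$, and (ii) $\lim_{t\uparrow1}z_t=b$ a.s. **Proposition.** (a) For every $t\in[0,1)$ the function $G_f(\cdot,t)$ is integrable on $[0,t]$, and $G_f$ satisfies (1) and (2). If moreover $f\ge0$ on $[0,1)$, then $G_f$ is an approximation to the identity. (b) Let $B$ be a standard Brownian motion on $\mathbb R^n$ on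 any probability space. The SDE $dy_t=dB_t-f(t)\,y_t\,dt$, $0\le t<1$, $y_0=0$, that is, $y_t=B_t-\int_0^tf(s)\,y_s\,ds$, has a solution with almost surely continuous paths, and any two such solutions are indistinguishable on $[0,1)$. Every such solution $(y_t)_{0\le t<1}$ is a Markov process with infinitesimal generator $\frac12\Delta-f(t)\nabla\big(\tfrac{r^2(\cdot,0)}2\big)$. (c) If moreover $f\ge0$ on $[t_1,1)$ for some $t_1<1$, then $\lim_{t\uparrow1}y_t=0$ a.s., and $y$, extended by $y_1=0$, has all the properties of a generalised Brownian bridge from $0$ to $0$, with $g=f$, except possibly (i'). (d) If moreover $\lim_{t\uparrow1}f(t)=\infty$, then $y$, extended by $y_1=0$, is a generalised Brownian bridge from $0$ to $0$. -/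

import Mathlib

open MeasureTheory ProbabilityTheory Filter Set
open scoped Topology NNReal

noncomputable section

/-! ### Approximations to the identity -/

/-- The two limits that define an approximation to the identity on `[0,1)`, for a real valued
`G` on `[0,1) × [0,1)` whose integrals `∫_0^t G(s,t) ds` exist. -/
structure HasApproxIdentityLimits (G : ℝ → ℝ → ℝ) : Prop where
  intervalIntegrable : ∀ t ∈ Ico (0 : ℝ) 1, IntervalIntegrable (fun s => G s t) volume 0 t
  tendsto_one : Tendsto (fun t => ∫ s in (0 : ℝ)..t, G s t) (𝓝[<] 1) (𝓝 1)
  tendsto_zero : ∀ t₀ ∈ Ico (0 : ℝ) 1,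
    Tendsto (fun t => ∫ s in (0 : ℝ)..t₀, G s t) (𝓝[<] 1) (𝓝 0)

/-- `G : [0,1) × [0,1) → ℝ₊` is an approximation to the identity. -/
structure IsApproxIdentity (G : ℝ → ℝ → ℝ) : Prop extends HasApproxIdentityLimits G where
  nonneg : ∀ s ∈ Ico (0 : ℝ) 1, ∀ t ∈ Ico (0 : ℝ) 1, 0 ≤ G s t

/-- `G_f(s,t) = f(s) exp(-∫_s^t f(r) dr)`. -/
def driftKernel (f : ℝ → ℝ) (s t : ℝ) : ℝ :=
  f s * Real.exp (-∫ r in s..t, f r)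

/-! ### Markov processes on `[0,1)` and their generators -/

/-- The `σ`-algebra generated by `z r`, `0 ≤ r ≤ s`. -/
@[reducible] def history {Ω E : Type*} [MeasurableSpace E] (z : ℝ → Ω → E) (s : ℝ) : MeasurableSpace Ω :=
  ⨆ r ∈ Icc (0 : ℝ) s, MeasurableSpace.comap (z r) inferInstance

/-- A (time inhomogeneous) family of Markov transition kernels `κ s t`, `0 ≤ s ≤ t < 1`,
satisfying the Chapman–Kolmogorov equations. -/
structure IsTransitionFamily {E : Type*} [MeasurableSpace E] (κ : ℝ → ℝ → Kernel E E) :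
    Prop where
  isMarkovKernel : ∀ s t, 0 ≤ s → s ≤ t → t < 1 → IsMarkovKernel (κ s t)
  refl : ∀ s, 0 ≤ s → s < 1 → κ s s = Kernel.id
  comp : ∀ s t u, 0 ≤ s → s ≤ t → t ≤ u → u < 1 → κ t u ∘ₖ κ s t = κ s u

/-- `(z t, 0 ≤ t < 1)` is a Markov process, for its own filtration, with transition kernels `κ`. -/
structure IsMarkovProcess {Ω E : Type*} [MeasurableSpace E] [MeasurableSpace Ω]
    (κ : ℝ → ℝ → Kernel E E) (z : ℝ → Ω → E) (μ : Measure Ω) : Prop where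
  isTransitionFamily : IsTransitionFamily κ
  measurable : ∀ t ∈ Ico (0 : ℝ) 1, Measurable (z t)
  markov : ∀ s t, 0 ≤ s → s ≤ t → t < 1 → ∀ A : Set E, MeasurableSet A →
    μ[(z t ⁻¹' A).indicator (fun _ => (1 : ℝ)) | history z s]
      =ᵐ[μ] fun ω => (κ s t (z s ω)).real A

/-- The operator `½ Δ φ - f(t) ⟨∇(r²(·, y₀)/2), ∇ φ⟩` on `ℝⁿ`, with `r` the distance. -/
def bridgeOperator {n : ℕ} (f : ℝ → ℝ) (y₀ : EuclideanSpace ℝ (Fin n)) (t : ℝ)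
    (φ : EuclideanSpace ℝ (Fin n) → ℝ) (x : EuclideanSpace ℝ (Fin n)) : ℝ :=
  (1 / 2) * Laplacian.laplacian φ x
    - f t * inner ℝ (gradient (fun w => dist w y₀ ^ 2 / 2) x) (gradient φ x)

/-- The transition kernels `κ` have the (time dependent) infinitesimal generator
`L_t = ½ Δ - f(t) ∇(r²(·, y₀)/2)`, tested on `φ ∈ C_c^∞(ℝⁿ)` and writing
`P_{s,t} φ x = ∫ φ d(κ s t x)`:
* `P_{s,t} φ = φ + ∫_s^t P_{s,r} (L_r φ) dr` for `0 ≤ s ≤ t < 1`;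
* at every time `s` at which `f` is right continuous, `(P_{s,s+h} φ - φ) / h → L_s φ`
  uniformly on `ℝⁿ` as `h ↓ 0`. -/
structure HasBridgeGenerator {n : ℕ} (f : ℝ → ℝ) (y₀ : EuclideanSpace ℝ (Fin n))
    (κ : ℝ → ℝ → Kernel (EuclideanSpace ℝ (Fin n)) (EuclideanSpace ℝ (Fin n))) : Prop where
  intervalIntegrable : ∀ φ : EuclideanSpace ℝ (Fin n) → ℝ, ContDiff ℝ (⊤ : ℕ∞) φ → HasCompactSupport φ →
    ∀ s t, 0 ≤ s → s ≤ t → t < 1 → ∀ x,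
      IntervalIntegrable (fun r => ∫ w, bridgeOperator f y₀ r φ w ∂(κ s r x)) volume s t
  integral_eq : ∀ φ : EuclideanSpace ℝ (Fin n) → ℝ, ContDiff ℝ (⊤ : ℕ∞) φ → HasCompactSupport φ →
    ∀ s t, 0 ≤ s → s ≤ t → t < 1 → ∀ x,
      ∫ w, φ w ∂(κ s t x) = φ x + ∫ r in s..t, ∫ w, bridgeOperator f y₀ r φ w ∂(κ s r x)
  tendstoUniformly : ∀ φ : EuclideanSpace ℝ (Fin n) → ℝ, ContDiff ℝ (⊤ : ℕ∞) φ → HasCompactSupport φ →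
    ∀ s ∈ Ico (0 : ℝ) 1, ContinuousWithinAt f (Ici s) s →
      TendstoUniformly (fun h x => (∫ w, φ w ∂(κ s (s + h) x) - φ x) / h)
        (bridgeOperator f y₀ s φ) (𝓝[>] 0)

/-- `(z t, 0 ≤ t < 1)` is a Markov process with infinitesimal generator
`½ Δ - f(t) ∇(r²(·, y₀)/2)`. -/
def IsMarkovWithDrift {Ω : Type*} [MeasurableSpace Ω] {n : ℕ} (f : ℝ → ℝ)
    (y₀ : EuclideanSpace ℝ (Fin n)) (z : ℝ → Ω → EuclideanSpace ℝ (Fin n)) (μ : Measure Ω) :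
    Prop :=
  ∃ κ : ℝ → ℝ → Kernel (EuclideanSpace ℝ (Fin n)) (EuclideanSpace ℝ (Fin n)),
    IsMarkovProcess κ z μ ∧ HasBridgeGenerator f y₀ κ

/-! ### Generalised Brownian bridges -/

/-- A process `(z t, 0 ≤ t ≤ 1)` with continuous paths from `x₀` to `y₀`, which on `[0,1)` is a
Markov process with generator `½ Δ - f(t) ∇(r²(·, y₀)/2)`. -/
structure IsBridgeWithDrift {Ω : Type*} [MeasurableSpace Ω] {n : ℕ} (f : ℝ → ℝ)
    (x₀ y₀ : EuclideanSpace ℝ (Fin n)) (z : ℝ → Ω → EuclideanSpace ℝ (Fin n)) (μ : Measure Ω) :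
    Prop where
  measurable : ∀ t ∈ Icc (0 : ℝ) 1, Measurable (z t)
  continuousOn : ∀ᵐ ω ∂μ, ContinuousOn (fun t => z t ω) (Icc 0 1)
  initial : ∀ᵐ ω ∂μ, z 0 ω = x₀
  markov : IsMarkovWithDrift f y₀ z μ
  tendsto : ∀ᵐ ω ∂μ, Tendsto (fun t => z t ω) (𝓝[<] 1) (𝓝 y₀)

/-- A generalised Brownian bridge from `x₀` to `y₀` with terminal time `1`: the drift coefficient
`f`, locally integrable on `[0,1)`, tends to infinity at time `1`. -/
def IsGeneralisedBrownianBridge {Ω : Type*} [MeasurableSpace Ω] {n : ℕ}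
    (x₀ y₀ : EuclideanSpace ℝ (Fin n)) (z : ℝ → Ω → EuclideanSpace ℝ (Fin n)) (μ : Measure Ω) :
    Prop :=
  ∃ f : ℝ → ℝ, (∀ t₀ ∈ Ioo (0 : ℝ) 1, IntervalIntegrable f volume 0 t₀) ∧
    Tendsto f (𝓝[<] 1) atTop ∧ IsBridgeWithDrift f x₀ y₀ z μ

/-! ### Brownian motion on `ℝⁿ` and the stochastic differential equation -/

/-- A standard Brownian motion on `ℝⁿ`: its coordinates are independent real Brownian motions. -/
structure IsBrownianMotion {Ω : Type*} [MeasurableSpace Ω] {n : ℕ}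
    (B : ℝ≥0 → Ω → EuclideanSpace ℝ (Fin n)) (μ : Measure Ω) : Prop where
  measurable : ∀ t, Measurable (B t)
  coord : ∀ i, IsBrownianReal (fun t ω => B t ω i) μ
  indep : iIndepFun (fun (i : Fin n) (ω : Ω) (t : ℝ≥0) => B t ω i) μ

/-- `(y t, 0 ≤ t < 1)` is a continuous solution of `dy = dB - f(t) y dt`, `y 0 = 0`: the noise
being additive, this is the integral equation `y t = B t - ∫_0^t f(s) y s ds`. -/
structure IsSDESolution {Ω : Type*} [MeasurableSpace Ω] {n : ℕ} (f : ℝ → ℝ)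
    (B : ℝ≥0 → Ω → EuclideanSpace ℝ (Fin n)) (y : ℝ → Ω → EuclideanSpace ℝ (Fin n))
    (μ : Measure Ω) : Prop where
  measurable : ∀ t ∈ Ico (0 : ℝ) 1, Measurable (y t)
  continuousOn : ∀ᵐ ω ∂μ, ContinuousOn (fun t => y t ω) (Ico 0 1)
  initial : ∀ᵐ ω ∂μ, y 0 ω = 0
  equation : ∀ᵐ ω ∂μ, ∀ t ∈ Ico (0 : ℝ) 1,
    y t ω = B t.toNNReal ω - ∫ s in (0 : ℝ)..t, f s • y s ω

end

/-! Write `F t = ∫_0^t f`. As `f` is only locally integrable, `F` is differentiable only almost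
everywhere, but `F` and `exp F` are absolutely continuous on compact subintervals of `[0,1)`, so the
fundamental theorem of calculus still applies. It gives `∫_a^b G_f(s,t) ds = exp(-F t) (exp(F b) -
exp(F a))` (`integral_driftKernel`), and part (a) follows from `F → ∞`.

The noise is additive, so the equation is solved path by path. The solution is `exp(-F t) ∫_0^t exp
F dB`, the integral being defined by integration by parts (`pathSolution_equation`); uniqueness uses
the integrating factor `exp F` (`eq_zero_of_homogeneous_equation`).

For the Markov property, `y t = exp(F s - F t) y s + exp(-F t) ∫_s^t exp F dB`
(`pathSolution_eq_add`). The last integral is a limit of Riemann sums in the increments of `B` after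
`s`. It is therefore independent of the past, and centred Gaussian with covariance `(∫_s^t exp(2F))
I` (`IsBrownianMotion.map_brownianIntegral`). Hence the transition law from `x` is that of `c x + σ
Z` with `Z` standard Gaussian, where `c` is `transitionScale` and `σ` is `transitionNoise`.

The generator comes from differentiating `E φ(c x + σ Z)` in time. Gaussian integration by parts
turns the `σ`-derivative into a Laplacian, and `c' = -f c`, `σ σ' = 1/2 - f σ²` yield `½ Δφ` minus
`f` times the radial derivative of `φ` (`hasDerivAt_transitionMean`). Absolute continuity integrates
this identity (`integral_generator`), and right continuity of `f` gives the uniform limit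
(`tendstoUniformly_generator`).

For (c), `y` is `b` minus an average of `b` against `G_f`. By the approximate identity property this
average tends to `b 1`, so `y → 0` (`tendsto_pathSolution`). Part (d) is then immediate. -/

/-! ### Absolutely continuous functions -/

section AbsolutelyContinuous

variable {X : Type*} [PseudoMetricSpace X]

/-- The variation sums of `f` over a disjoint family are dominated by those of `g` and `h`. Two
dominating functions are allowed because Gaussian means depend on both a scale and a standard
deviation. -/
theorem AbsolutelyContinuousOnInterval.of_dist_le {Y Z : Type*} [PseudoMetricSpace Y]
    [PseudoMetricSpace Z] {f : ℝ → X} {g : ℝ → Y} {h : ℝ → Z} {a b : ℝ} (K L : ℝ)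
    (hg : AbsolutelyContinuousOnInterval g a b) (hh : AbsolutelyContinuousOnInterval h a b)
    (hle : ∀ x ∈ uIcc a b, ∀ y ∈ uIcc a b,
      dist (f x) (f y) ≤ K * dist (g x) (g y) + L * dist (h x) (h y)) :
    AbsolutelyContinuousOnInterval f a b := by
  have hlim : Tendsto (fun E : ℕ × (ℕ → ℝ × ℝ) =>
      K * (∑ i ∈ Finset.range E.1, dist (g (E.2 i).1) (g (E.2 i).2))
        + L * ∑ i ∈ Finset.range E.1, dist (h (E.2 i).1) (h (E.2 i).2))
      (AbsolutelyContinuousOnInterval.totalLengthFilter ⊓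
        𝓟 (AbsolutelyContinuousOnInterval.disjWithin a b)) (𝓝 0) := by
    simpa using (Tendsto.const_mul K hg).add (Tendsto.const_mul L hh)
  refine squeeze_zero' (Eventually.of_forall fun E => Finset.sum_nonneg fun i _ => dist_nonneg)
    ?_ hlim
  filter_upwards [mem_inf_of_right (mem_principal_self _)] with E hE
  rw [Finset.mul_sum, Finset.mul_sum, ← Finset.sum_add_distrib]
  exact Finset.sum_le_sum fun i hi => hle _ (hE.1 i hi).1 _ (hE.1 i hi).2

theorem LipschitzOnWith.comp_absolutelyContinuousOnInterval {Y : Type*} [PseudoMetricSpace Y]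
    {φ : Y → X} {g : ℝ → Y} {a b : ℝ} {K : ℝ≥0} {s : Set Y} (hφ : LipschitzOnWith K φ s)
    (hs : ∀ x ∈ uIcc a b, g x ∈ s) (hg : AbsolutelyContinuousOnInterval g a b) :
    AbsolutelyContinuousOnInterval (fun x => φ (g x)) a b :=
  .of_dist_le (K : ℝ) 0 hg hg fun x hx y hy => by
    simpa using hφ.dist_le_mul _ (hs x hx) _ (hs y hy)

/-- An absolutely continuous function on a compact interval is bounded, and `φ` is Lipschitz on its
bounded range. -/
theorem ContDiff.comp_absolutelyContinuousOnInterval {φ g : ℝ → ℝ} {a b : ℝ}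
    (hφ : ContDiff ℝ 1 φ) (hg : AbsolutelyContinuousOnInterval g a b) :
    AbsolutelyContinuousOnInterval (fun x => φ (g x)) a b := by
  obtain ⟨C, hC⟩ := hg.exists_bound
  obtain ⟨K, hK⟩ := (hφ.contDiffOn (s := Icc (-C) C)).exists_lipschitzOnWith one_ne_zero
    (convex_Icc _ _) isCompact_Icc
  exact hK.comp_absolutelyContinuousOnInterval (fun x hx => abs_le.1 (hC x hx)) hg

variable {G : Type*} [NormedAddCommGroup G] [NormedSpace ℝ G]

theorem IntervalIntegrable.absolutelyContinuousOnInterval_primitive {g : ℝ → G} {a b c : ℝ}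
    (hg : IntervalIntegrable g volume a b) (hc : c ∈ uIcc a b) :
    AbsolutelyContinuousOnInterval (fun x => ∫ r in c..x, g r) a b := by
  have h := hg.norm.absolutelyContinuousOnInterval_intervalIntegral hc
  refine .of_dist_le 1 0 h h fun x hx y hy => ?_
  have key : ∀ x ∈ uIcc a b, ∀ y ∈ uIcc a b, IntervalIntegrable g volume x y := fun x hx y hy =>
    hg.mono_set (uIcc_subset_uIcc hx hy)
  rw [one_mul, zero_mul, add_zero, dist_eq_norm, dist_eq_norm,
    intervalIntegral.integral_interval_sub_left (key c hc x hx) (key c hc y hy),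
    intervalIntegral.integral_interval_sub_left (key c hc x hx).norm (key c hc y hy).norm]
  exact intervalIntegral.norm_integral_le_abs_integral_norm

/-- The fundamental theorem of calculus for absolutely continuous vector valued functions. -/
theorem AbsolutelyContinuousOnInterval.integral_eq_sub_of_ae_hasDerivAt [CompleteSpace G]
    {g g' : ℝ → G} {a b : ℝ} (hg : AbsolutelyContinuousOnInterval g a b)
    (hg' : ∀ᵐ x, x ∈ uIcc a b → HasDerivAt g (g' x) x) (hint : IntervalIntegrable g' volume a b) :
    ∫ x in a..b, g' x = g b - g a := by
  obtain ⟨C, hC⟩ := (hg.sub (hint.absolutelyContinuousOnInterval_primitive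
    (c := a) left_mem_uIcc)).const_of_ae_hasDerivAt_zero (by
      filter_upwards [hg', hint.ae_hasDerivAt_integral] with x h1 h2 hx
      simpa using (h1 hx).sub (h2 hx a left_mem_uIcc))
  have ha := hC a left_mem_uIcc
  have hb := hC b right_mem_uIcc
  simp only [Pi.sub_apply, intervalIntegral.integral_same, sub_zero] at ha hb
  rw [ha, ← hb, sub_sub_cancel]

end AbsolutelyContinuous

/-! ### The drift coefficient and its primitive -/

section Drift

/-- Integrability of `f` on every compact subinterval of `[0,1)`. -/
def IsDriftCoefficient (f : ℝ → ℝ) : Prop :=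
  ∀ t₀ ∈ Ioo (0 : ℝ) 1, IntervalIntegrable f volume 0 t₀

/-- `F t = ∫_0^t f`. -/
noncomputable def driftPrimitive (f : ℝ → ℝ) (t : ℝ) : ℝ := ∫ r in (0 : ℝ)..t, f r

/-- The derivative `f * exp F` of `exp F`. -/
noncomputable def driftWeight (f : ℝ → ℝ) (t : ℝ) : ℝ := f t * Real.exp (driftPrimitive f t)

/-- The clock `∫_0^t exp (2 F)`. -/
noncomputable def driftClock (f : ℝ → ℝ) (t : ℝ) : ℝ :=
  ∫ r in (0 : ℝ)..t, Real.exp (2 * driftPrimitive f r)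

variable {f : ℝ → ℝ} {s t : ℝ}

theorem uIcc_subset_Ico_zero_one (hs : s ∈ Ico (0 : ℝ) 1) (ht : t ∈ Ico (0 : ℝ) 1) :
    uIcc s t ⊆ Ico 0 1 := fun _ hx =>
  ⟨(le_min hs.1 ht.1).trans hx.1, hx.2.trans_lt (max_lt hs.2 ht.2)⟩

namespace IsDriftCoefficient

theorem intervalIntegrable (hf : IsDriftCoefficient f) (hs : s ∈ Ico (0 : ℝ) 1)
    (ht : t ∈ Ico (0 : ℝ) 1) : IntervalIntegrable f volume s t := by
  have key : ∀ t ∈ Ico (0 : ℝ) 1, IntervalIntegrable f volume 0 t := fun t ht => by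
    rcases ht.1.eq_or_lt with rfl | h
    · exact .refl
    · exact hf t ⟨h, ht.2⟩
  exact (key s hs).symm.trans (key t ht)

theorem primitive_sub (hf : IsDriftCoefficient f) (hs : s ∈ Ico (0 : ℝ) 1)
    (ht : t ∈ Ico (0 : ℝ) 1) : driftPrimitive f t - driftPrimitive f s = ∫ r in s..t, f r :=
  intervalIntegral.integral_interval_sub_left
    (hf.intervalIntegrable ⟨le_rfl, one_pos⟩ ht) (hf.intervalIntegrable ⟨le_rfl, one_pos⟩ hs)

theorem absolutelyContinuousOnInterval (hf : IsDriftCoefficient f) (hs : s ∈ Ico (0 : ℝ) 1)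
    (ht : t ∈ Ico (0 : ℝ) 1) : AbsolutelyContinuousOnInterval (driftPrimitive f) s t := by
  have h := ((hf.intervalIntegrable ⟨le_rfl, one_pos⟩
    ⟨hs.1.trans (le_max_left s t), max_lt hs.2 ht.2⟩).absolutelyContinuousOnInterval_intervalIntegral
      left_mem_uIcc)
  refine h.mono ?_
  rw [uIcc_of_le (hs.1.trans (le_max_left s t))]
  exact fun x hx => ⟨(le_min hs.1 ht.1).trans hx.1, hx.2⟩

theorem ae_hasDerivAt (hf : IsDriftCoefficient f) (hs : s ∈ Ico (0 : ℝ) 1)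
    (ht : t ∈ Ico (0 : ℝ) 1) :
    ∀ᵐ x, x ∈ uIcc s t → HasDerivAt (driftPrimitive f) (f x) x := by
  have hm : max s t ∈ Ico (0 : ℝ) 1 := ⟨hs.1.trans (le_max_left s t), max_lt hs.2 ht.2⟩
  filter_upwards [(hf.intervalIntegrable ⟨le_rfl, one_pos⟩ hm).ae_hasDerivAt_integral] with x h hx
  refine h ?_ 0 left_mem_uIcc
  rw [uIcc_of_le hm.1]
  exact ⟨(le_min hs.1 ht.1).trans hx.1, hx.2⟩

theorem continuousOn_primitive (hf : IsDriftCoefficient f) :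
    ContinuousOn (driftPrimitive f) (Ico 0 1) := by
  intro x hx
  obtain ⟨y, hxy, hy⟩ := exists_between hx.2
  have h := (hf.absolutelyContinuousOnInterval ⟨le_rfl, one_pos⟩ ⟨hx.1.trans hxy.le, hy⟩).continuousOn
  rw [uIcc_of_le (hx.1.trans hxy.le)] at h
  refine (h x ⟨hx.1, hxy.le⟩).mono_of_mem_nhdsWithin ?_
  rw [mem_nhdsWithin]
  exact ⟨Iio y, isOpen_Iio, hxy, fun z hz => ⟨hz.2.1, hz.1.le⟩⟩

theorem continuousOn_exp (hf : IsDriftCoefficient f) (c : ℝ) :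
    ContinuousOn (fun t => Real.exp (c * driftPrimitive f t)) (Ico 0 1) :=
  (hf.continuousOn_primitive.const_smul c).rexp

theorem absolutelyContinuousOnInterval_exp (hf : IsDriftCoefficient f) (c : ℝ)
    (hs : s ∈ Ico (0 : ℝ) 1) (ht : t ∈ Ico (0 : ℝ) 1) :
    AbsolutelyContinuousOnInterval (fun t => Real.exp (c * driftPrimitive f t)) s t :=
  ContDiff.comp_absolutelyContinuousOnInterval (φ := fun x => Real.exp (c * x)) (by fun_prop)
    (hf.absolutelyContinuousOnInterval hs ht)

theorem ae_hasDerivAt_exp (hf : IsDriftCoefficient f) (c : ℝ)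
    (hs : s ∈ Ico (0 : ℝ) 1) (ht : t ∈ Ico (0 : ℝ) 1) :
    ∀ᵐ x, x ∈ uIcc s t → HasDerivAt (fun t => Real.exp (c * driftPrimitive f t))
      (c * f x * Real.exp (c * driftPrimitive f x)) x := by
  filter_upwards [hf.ae_hasDerivAt hs ht] with x h hx
  simpa [mul_comm, mul_left_comm] using ((h hx).const_mul c).exp

theorem intervalIntegrable_smul {E : Type*} [NormedAddCommGroup E] [NormedSpace ℝ E]
    (hf : IsDriftCoefficient f) (hs : s ∈ Ico (0 : ℝ) 1) (ht : t ∈ Ico (0 : ℝ) 1)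
    {b : ℝ → E} (hb : ContinuousOn b (Ico 0 1)) :
    IntervalIntegrable (fun r => f r • b r) volume s t :=
  (hf.intervalIntegrable hs ht).smul_continuousOn (hb.mono (uIcc_subset_Ico_zero_one hs ht))

theorem continuousOn_exp_primitive (hf : IsDriftCoefficient f) :
    ContinuousOn (fun t => Real.exp (driftPrimitive f t)) (Ico 0 1) := by
  simpa using hf.continuousOn_exp 1

theorem intervalIntegrable_weight (hf : IsDriftCoefficient f) (hs : s ∈ Ico (0 : ℝ) 1)
    (ht : t ∈ Ico (0 : ℝ) 1) : IntervalIntegrable (driftWeight f) volume s t :=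
  hf.intervalIntegrable_smul hs ht hf.continuousOn_exp_primitive

theorem intervalIntegrable_weight_smul {E : Type*} [NormedAddCommGroup E] [NormedSpace ℝ E]
    (hf : IsDriftCoefficient f) (hs : s ∈ Ico (0 : ℝ) 1) (ht : t ∈ Ico (0 : ℝ) 1)
    {b : ℝ → E} (hb : ContinuousOn b (Ico 0 1)) :
    IntervalIntegrable (fun r => driftWeight f r • b r) volume s t := by
  simpa [driftWeight, mul_smul] using
    hf.intervalIntegrable_smul hs ht (hf.continuousOn_exp_primitive.smul hb)

theorem integral_weight (hf : IsDriftCoefficient f) (hs : s ∈ Ico (0 : ℝ) 1)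
    (ht : t ∈ Ico (0 : ℝ) 1) :
    ∫ r in s..t, driftWeight f r
      = Real.exp (driftPrimitive f t) - Real.exp (driftPrimitive f s) := by
  have h := (hf.absolutelyContinuousOnInterval_exp 1 hs ht).integral_eq_sub_of_ae_hasDerivAt
    (hf.ae_hasDerivAt_exp 1 hs ht) (by
      simp only [one_mul]
      exact hf.intervalIntegrable_weight hs ht)
  simpa [driftWeight] using h

theorem intervalIntegrable_exp (hf : IsDriftCoefficient f) (c : ℝ) (hs : s ∈ Ico (0 : ℝ) 1)
    (ht : t ∈ Ico (0 : ℝ) 1) :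
    IntervalIntegrable (fun t => Real.exp (c * driftPrimitive f t)) volume s t :=
  ((hf.continuousOn_exp c).mono (uIcc_subset_Ico_zero_one hs ht)).intervalIntegrable

theorem clock_sub (hf : IsDriftCoefficient f) (hs : s ∈ Ico (0 : ℝ) 1) (ht : t ∈ Ico (0 : ℝ) 1) :
    driftClock f t - driftClock f s = ∫ r in s..t, Real.exp (2 * driftPrimitive f r) :=
  intervalIntegral.integral_interval_sub_left
    (hf.intervalIntegrable_exp 2 ⟨le_rfl, one_pos⟩ ht)
    (hf.intervalIntegrable_exp 2 ⟨le_rfl, one_pos⟩ hs)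

theorem clock_mono (hf : IsDriftCoefficient f) (hs : s ∈ Ico (0 : ℝ) 1)
    (ht : t ∈ Ico (0 : ℝ) 1) (hst : s ≤ t) : driftClock f s ≤ driftClock f t := by
  rw [← sub_nonneg, hf.clock_sub hs ht]
  exact intervalIntegral.integral_nonneg hst fun _ _ => (Real.exp_pos _).le

/-- Strictness makes the transition variance positive as soon as `s < t`, which is what allows its
square root to be differentiated. -/
theorem clock_lt (hf : IsDriftCoefficient f) (hs : s ∈ Ico (0 : ℝ) 1)
    (ht : t ∈ Ico (0 : ℝ) 1) (hst : s < t) : driftClock f s < driftClock f t := by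
  rw [← sub_pos, hf.clock_sub hs ht]
  exact intervalIntegral.intervalIntegral_pos_of_pos (hf.intervalIntegrable_exp 2 hs ht)
    (fun _ => Real.exp_pos _) hst

theorem continuousOn_clock (hf : IsDriftCoefficient f) : ContinuousOn (driftClock f) (Ico 0 1) := by
  intro x hx
  obtain ⟨y, hxy, hy⟩ := exists_between hx.2
  have h := ((hf.intervalIntegrable_exp 2 ⟨le_rfl, one_pos⟩
    ⟨hx.1.trans hxy.le, hy⟩).absolutelyContinuousOnInterval_primitive left_mem_uIcc).continuousOn
  rw [uIcc_of_le (hx.1.trans hxy.le)] at h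
  refine (h x ⟨hx.1, hxy.le⟩).mono_of_mem_nhdsWithin ?_
  rw [mem_nhdsWithin]
  exact ⟨Iio y, isOpen_Iio, hxy, fun z hz => ⟨hz.2.1, hz.1.le⟩⟩

/-- The integrand is continuous, so, unlike for `F`, the derivative exists at every interior time.
-/
theorem hasDerivAt_clock (hf : IsDriftCoefficient f) (ht : t ∈ Ioo (0 : ℝ) 1) :
    HasDerivAt (driftClock f) (Real.exp (2 * driftPrimitive f t)) t := by
  have hc : ContinuousOn (fun t => Real.exp (2 * driftPrimitive f t)) (Ioo 0 1) :=
    (hf.continuousOn_exp 2).mono Ioo_subset_Ico_self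
  exact intervalIntegral.integral_hasDerivAt_right
    (hf.intervalIntegrable_exp 2 ⟨le_rfl, one_pos⟩ ⟨ht.1.le, ht.2⟩)
    (hc.stronglyMeasurableAtFilter isOpen_Ioo t ht)
    (hc.continuousAt (isOpen_Ioo.mem_nhds ht))

end IsDriftCoefficient

/-! ### The kernel `G_f` -/

/-- The variables separate: in `s` the kernel is a multiple of the derivative of `exp F`, so its
integrals are explicit. -/
theorem driftKernel_eq (hf : IsDriftCoefficient f) (hs : s ∈ Ico (0 : ℝ) 1)
    (ht : t ∈ Ico (0 : ℝ) 1) :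
    driftKernel f s t = Real.exp (-driftPrimitive f t) * driftWeight f s := by
  rw [driftKernel, ← hf.primitive_sub hs ht, driftWeight, neg_sub, sub_eq_add_neg, Real.exp_add]
  ring

theorem integral_driftKernel (hf : IsDriftCoefficient f) {a b : ℝ} (ha : a ∈ Ico (0 : ℝ) 1)
    (hb : b ∈ Ico (0 : ℝ) 1) (ht : t ∈ Ico (0 : ℝ) 1) :
    ∫ s in a..b, driftKernel f s t = Real.exp (-driftPrimitive f t) *
      (Real.exp (driftPrimitive f b) - Real.exp (driftPrimitive f a)) := by
  rw [← hf.integral_weight ha hb, ← intervalIntegral.integral_const_mul]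
  exact intervalIntegral.integral_congr fun s hs =>
    driftKernel_eq hf (uIcc_subset_Ico_zero_one ha hb hs) ht

theorem Ico_mem_nhdsLT_one : Ico (0 : ℝ) 1 ∈ 𝓝[<] (1 : ℝ) :=
  Ico_mem_nhdsLT one_pos

theorem hasApproxIdentityLimits_driftKernel (hf : IsDriftCoefficient f)
    (hlim : Tendsto (driftPrimitive f) (𝓝[<] 1) atTop) :
    HasApproxIdentityLimits (driftKernel f) where
  intervalIntegrable t ht :=
    ((hf.intervalIntegrable_weight ⟨le_rfl, one_pos⟩ ht).const_mul
      (Real.exp (-driftPrimitive f t))).congr fun s hs =>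
      (driftKernel_eq hf (uIcc_subset_Ico_zero_one ⟨le_rfl, one_pos⟩ ht
        (uIoc_subset_uIcc hs)) ht).symm
  tendsto_one := by
    have h : Tendsto (fun t => 1 - Real.exp (-driftPrimitive f t)) (𝓝[<] 1) (𝓝 (1 - 0)) :=
      tendsto_const_nhds.sub (Real.tendsto_exp_neg_atTop_nhds_zero.comp hlim)
    rw [sub_zero] at h
    refine h.congr' ?_
    filter_upwards [Ico_mem_nhdsLT_one] with t ht
    rw [integral_driftKernel hf ⟨le_rfl, one_pos⟩ ht ht, mul_sub, ← Real.exp_add]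
    simp [driftPrimitive]
  tendsto_zero t₀ ht₀ := by
    have h := (Real.tendsto_exp_neg_atTop_nhds_zero.comp hlim).mul_const
      (Real.exp (driftPrimitive f t₀) - Real.exp (driftPrimitive f 0))
    rw [zero_mul] at h
    refine h.congr' ?_
    filter_upwards [Ico_mem_nhdsLT_one] with t ht
    rw [integral_driftKernel hf ⟨le_rfl, one_pos⟩ ht₀ ht]
    rfl

theorem isApproxIdentity_driftKernel (hf : IsDriftCoefficient f)
    (hlim : Tendsto (driftPrimitive f) (𝓝[<] 1) atTop) (hpos : ∀ s ∈ Ico (0 : ℝ) 1, 0 ≤ f s) :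
    IsApproxIdentity (driftKernel f) where
  toHasApproxIdentityLimits := hasApproxIdentityLimits_driftKernel hf hlim
  nonneg s hs _ _ := mul_nonneg (hpos s hs) (Real.exp_pos _).le

end Drift

/-! ### Variation of constants along a path -/

section VariationOfConstants

variable {E : Type*} [NormedAddCommGroup E] [NormedSpace ℝ E] {f : ℝ → ℝ} {b y : ℝ → E} {s t : ℝ}

/-- The pathwise stochastic integral `∫_s^t exp (F r) db r`, defined by integration by parts. -/
noncomputable def pathIntegral (f : ℝ → ℝ) (b : ℝ → E) (s t : ℝ) : E :=
  Real.exp (driftPrimitive f t) • b t - Real.exp (driftPrimitive f s) • b s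
    - ∫ r in s..t, driftWeight f r • b r

/-- The solution `exp (-F t) ∫_0^t exp (F r) db r` of `y t = b t - ∫_0^t f y`. -/
noncomputable def pathSolution (f : ℝ → ℝ) (b : ℝ → E) (t : ℝ) : E :=
  Real.exp (-driftPrimitive f t) • pathIntegral f b 0 t

/-- The subtracted term is the average of `b` against `G_f(·, t)`. Both the integral equation and
the limit at time `1` are read off this form. -/
theorem pathSolution_eq (hb0 : b 0 = 0) (t : ℝ) :
    pathSolution f b t = b t -
      Real.exp (-driftPrimitive f t) • ∫ r in (0 : ℝ)..t, driftWeight f r • b r := by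
  rw [pathSolution, pathIntegral, hb0, smul_zero, sub_zero, smul_sub, smul_smul, ← Real.exp_add,
    neg_add_cancel, Real.exp_zero, one_smul]

theorem pathIntegral_add (hf : IsDriftCoefficient f) (hb : ContinuousOn b (Ico 0 1))
    (hs : s ∈ Ico (0 : ℝ) 1) (ht : t ∈ Ico (0 : ℝ) 1) :
    pathIntegral f b 0 s + pathIntegral f b s t = pathIntegral f b 0 t := by
  have h0 : (0 : ℝ) ∈ Ico (0 : ℝ) 1 := ⟨le_rfl, one_pos⟩
  rw [pathIntegral, pathIntegral, pathIntegral, ← intervalIntegral.integral_add_adjacent_intervals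
    (hf.intervalIntegrable_weight_smul h0 hs hb) (hf.intervalIntegrable_weight_smul hs ht hb)]
  abel

/-- The pathwise source of the Markov property: the present state enters linearly, and the rest
depends only on the path after time `s`. -/
theorem pathSolution_eq_add (hf : IsDriftCoefficient f) (hb : ContinuousOn b (Ico 0 1))
    (hs : s ∈ Ico (0 : ℝ) 1) (ht : t ∈ Ico (0 : ℝ) 1) :
    pathSolution f b t =
      Real.exp (driftPrimitive f s - driftPrimitive f t) • pathSolution f b s
        + Real.exp (-driftPrimitive f t) • pathIntegral f b s t := by
  rw [pathSolution, pathSolution, ← pathIntegral_add hf hb hs ht, smul_add, smul_smul,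
    ← Real.exp_add]
  congr 3
  ring

theorem continuousOn_primitive_weight (hf : IsDriftCoefficient f) (hb : ContinuousOn b (Ico 0 1)) :
    ContinuousOn (fun t => ∫ r in (0 : ℝ)..t, driftWeight f r • b r) (Ico 0 1) := by
  intro x hx
  obtain ⟨y, hxy, hy⟩ := exists_between hx.2
  have h := ((hf.intervalIntegrable_weight_smul ⟨le_rfl, one_pos⟩
    ⟨hx.1.trans hxy.le, hy⟩ hb).absolutelyContinuousOnInterval_primitive left_mem_uIcc).continuousOn
  rw [uIcc_of_le (hx.1.trans hxy.le)] at h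
  refine (h x ⟨hx.1, hxy.le⟩).mono_of_mem_nhdsWithin ?_
  rw [mem_nhdsWithin]
  exact ⟨Iio y, isOpen_Iio, hxy, fun z hz => ⟨hz.2.1, hz.1.le⟩⟩

theorem continuousOn_pathSolution (hf : IsDriftCoefficient f) (hb : ContinuousOn b (Ico 0 1)) :
    ContinuousOn (pathSolution f b) (Ico 0 1) := by
  have h1 := hf.continuousOn_exp (-1)
  simp only [neg_mul, one_mul] at h1
  exact h1.smul (((hf.continuousOn_exp_primitive.smul hb).sub continuousOn_const).sub
    (continuousOn_primitive_weight hf hb))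

variable [CompleteSpace E]

/-- Let `A = exp(-F) ∫ f exp(F) b`, so that the solution is `b - A`. Almost everywhere `A' = -f A +
f b = f (b - A)`, and integrating `A'` gives the equation. -/
theorem pathSolution_equation (hf : IsDriftCoefficient f) (hb : ContinuousOn b (Ico 0 1))
    (hb0 : b 0 = 0) (ht : t ∈ Ico (0 : ℝ) 1) :
    pathSolution f b t = b t - ∫ r in (0 : ℝ)..t, f r • pathSolution f b r := by
  have h0 : (0 : ℝ) ∈ Ico (0 : ℝ) 1 := ⟨le_rfl, one_pos⟩
  have hint := hf.intervalIntegrable_weight_smul h0 ht hb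
  have hac : AbsolutelyContinuousOnInterval (fun t => Real.exp (-1 * driftPrimitive f t) •
      ∫ r in (0 : ℝ)..t, driftWeight f r • b r) 0 t :=
    (hf.absolutelyContinuousOnInterval_exp (-1) h0 ht).smul
      (hint.absolutelyContinuousOnInterval_primitive left_mem_uIcc)
  have key := hac.integral_eq_sub_of_ae_hasDerivAt (g' := fun r => f r • pathSolution f b r) (by
      filter_upwards [hf.ae_hasDerivAt_exp (-1) h0 ht, hint.ae_hasDerivAt_integral] with r h1 h2 hr
      convert! (h1 hr).smul (h2 hr 0 left_mem_uIcc) using 1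
      rw [pathSolution_eq hb0, driftWeight, smul_sub, smul_smul, smul_smul,
        show Real.exp (-1 * driftPrimitive f r) * (f r * Real.exp (driftPrimitive f r)) = f r by
          rw [mul_left_comm, ← Real.exp_add]; simp]
      rw [sub_eq_add_neg, ← neg_smul]
      congr 2
      rw [neg_one_mul (driftPrimitive f r)]
      ring)
    (hf.intervalIntegrable_smul h0 ht (continuousOn_pathSolution hf hb))
  rw [key, pathSolution_eq hb0]
  simp

/-- The integrating factor `exp F` makes `exp(F) ∫ f d` absolutely continuous with a.e. derivative
`f exp(F) (∫ f d + d) = 0`. -/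
theorem eq_zero_of_homogeneous_equation (hf : IsDriftCoefficient f) {d : ℝ → E}
    (hd : ContinuousOn d (Ico 0 1))
    (heq : ∀ t ∈ Ico (0 : ℝ) 1, d t = - ∫ r in (0 : ℝ)..t, f r • d r)
    (ht : t ∈ Ico (0 : ℝ) 1) : d t = 0 := by
  have h0 : (0 : ℝ) ∈ Ico (0 : ℝ) 1 := ⟨le_rfl, one_pos⟩
  have hint := hf.intervalIntegrable_smul h0 ht hd
  have hac : AbsolutelyContinuousOnInterval (fun t => Real.exp (1 * driftPrimitive f t) •
      ∫ r in (0 : ℝ)..t, f r • d r) 0 t :=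
    (hf.absolutelyContinuousOnInterval_exp 1 h0 ht).smul
      (hint.absolutelyContinuousOnInterval_primitive left_mem_uIcc)
  have key := hac.integral_eq_sub_of_ae_hasDerivAt (g' := fun _ => (0 : E)) (by
      filter_upwards [hf.ae_hasDerivAt_exp 1 h0 ht, hint.ae_hasDerivAt_integral] with r h1 h2 hr
      convert! (h1 hr).smul (h2 hr 0 left_mem_uIcc) using 1
      rw [heq r (uIcc_subset_Ico_zero_one h0 ht hr), smul_neg, smul_neg, smul_smul,
        ← neg_smul, ← add_smul]
      simp [mul_comm])
    (by simp)
  simp only [intervalIntegral.integral_zero, intervalIntegral.integral_same, smul_zero,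
    sub_zero] at key
  rw [heq t ht, (smul_eq_zero.1 key.symm).resolve_left (Real.exp_pos _).ne', neg_zero]

theorem eq_of_equation (hf : IsDriftCoefficient f) {y y' : ℝ → E}
    (hy : ContinuousOn y (Ico 0 1)) (hy' : ContinuousOn y' (Ico 0 1))
    (heq : ∀ t ∈ Ico (0 : ℝ) 1, y t = b t - ∫ r in (0 : ℝ)..t, f r • y r)
    (heq' : ∀ t ∈ Ico (0 : ℝ) 1, y' t = b t - ∫ r in (0 : ℝ)..t, f r • y' r)
    (ht : t ∈ Ico (0 : ℝ) 1) : y t = y' t := by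
  have h0 : (0 : ℝ) ∈ Ico (0 : ℝ) 1 := ⟨le_rfl, one_pos⟩
  refine sub_eq_zero.1 (eq_zero_of_homogeneous_equation hf (hy.sub hy') (fun r hr => ?_) ht)
  simp only [Pi.sub_apply, smul_sub]
  rw [intervalIntegral.integral_sub (hf.intervalIntegrable_smul h0 hr hy)
    (hf.intervalIntegrable_smul h0 hr hy')]
  nth_rw 1 [heq r hr, heq' r hr]
  abel

/-! ### Riemann sums -/

/-- The Riemann sums of `∫_s^t exp (F r) db r` for the partition into `k` equal intervals. -/
noncomputable def riemannSum (w : ℝ → ℝ) (b : ℝ → E) (s t : ℝ) (k : ℕ) : E :=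
  ∑ i ∈ Finset.range k, w (s + (t - s) * (i / k)) •
    (b (s + (t - s) * ((i + 1 : ℕ) / k)) - b (s + (t - s) * (i / k)))

theorem partition_mem_Icc (hst : s ≤ t) {i k : ℕ} (hik : i ≤ k) :
    s + (t - s) * (i / k) ∈ Icc s t := by
  have h0 : (0 : ℝ) ≤ i / k := by positivity
  have h1 : (i / k : ℝ) ≤ 1 := div_le_one_of_le₀ (by exact_mod_cast hik) (by positivity)
  constructor <;> nlinarith

theorem partition_mono (hst : s ≤ t) (i k : ℕ) :
    s + (t - s) * (i / k) ≤ s + (t - s) * ((i + 1 : ℕ) / k) := by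
  have : (i / k : ℝ) ≤ (i + 1 : ℕ) / k := by gcongr; simp
  gcongr

/-- On each cell, Riemann term and integration by parts differ by the integral of `w'` against `b r
- b (right endpoint)`. Uniform continuity of `b` and integrability of `w'` suffice; no bounded
variation of `b` is required, so Brownian paths are covered. -/
theorem tendsto_riemannSum {w w' : ℝ → ℝ} (hst : s ≤ t)
    (hw : IntervalIntegrable w' volume s t)
    (hw' : ∀ x ∈ Icc s t, ∀ y ∈ Icc s t, ∫ r in x..y, w' r = w y - w x)
    (hb : ContinuousOn b (Icc s t)) :
    Tendsto (riemannSum w b s t) atTop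
      (𝓝 (w t • b t - w s • b s - ∫ r in s..t, w' r • b r)) := by
  have hu := isCompact_Icc.uniformContinuousOn_of_continuous hb
  rw [Metric.uniformContinuousOn_iff] at hu
  set I := ∫ r in s..t, ‖w' r‖ with hI
  have hI0 : 0 ≤ I := intervalIntegral.integral_nonneg hst fun _ _ => norm_nonneg _
  rw [Metric.tendsto_atTop]
  intro ε hε
  -- The total error is at most `ε / (I + 1) * I < ε`; the `+ 1` covers the case `I = 0`.
  obtain ⟨δ, hδ, hbδ⟩ := hu (ε / (I + 1)) (by positivity)
  obtain ⟨N, hN⟩ := exists_nat_gt ((t - s) / δ)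
  refine ⟨N + 1, fun k hk => ?_⟩
  have hk0 : (0 : ℝ) < k := by exact_mod_cast (by omega : 0 < k)
  have hmesh : (t - s) / k < δ := by
    rw [div_lt_iff₀ hk0]
    rw [div_lt_iff₀ hδ] at hN
    have : (N : ℝ) ≤ k := by exact_mod_cast (by omega : N ≤ k)
    nlinarith
  set p : ℕ → ℝ := fun i => s + (t - s) * (i / k) with hp
  have hp0 : p 0 = s := by simp [hp]
  have hpk : p k = t := by simp [hp, hk0.ne']
  have hmem : ∀ i ≤ k, p i ∈ Icc s t := fun i hi => partition_mem_Icc hst hi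
  have hmono : ∀ i, p i ≤ p (i + 1) := fun i => partition_mono hst i k
  have hsub : ∀ i < k, uIcc (p i) (p (i + 1)) ⊆ uIcc s t := fun i hi => by
    rw [uIcc_of_le hst, uIcc_of_le (hmono i)]
    exact Icc_subset_Icc (hmem i hi.le).1 (hmem (i + 1) hi).2
  have hwb : IntervalIntegrable (fun r => w' r • b r) volume s t :=
    hw.smul_continuousOn (by rwa [uIcc_of_le hst])
  have e1 : riemannSum w b s t k = ∑ i ∈ Finset.range k, w (p i) • (b (p (i + 1)) - b (p i)) := rfl
  have e2 : w t • b t - w s • b s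
      = ∑ i ∈ Finset.range k, (w (p (i + 1)) • b (p (i + 1)) - w (p i) • b (p i)) := by
    rw [Finset.sum_range_sub (fun i => w (p i) • b (p i)), hp0, hpk]
  have e3 : ∫ r in s..t, w' r • b r
      = ∑ i ∈ Finset.range k, ∫ r in p i..p (i + 1), w' r • b r := by
    rw [intervalIntegral.sum_integral_adjacent_intervals fun i hi => hwb.mono_set (hsub i hi),
      hp0, hpk]
  have e4 : I = ∑ i ∈ Finset.range k, ∫ r in p i..p (i + 1), ‖w' r‖ := by
    rw [intervalIntegral.sum_integral_adjacent_intervals fun i hi => hw.norm.mono_set (hsub i hi),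
      hp0, hpk]
  rw [dist_eq_norm, e1, e2, e3, ← Finset.sum_sub_distrib, ← Finset.sum_sub_distrib]
  have hterm : ∀ i ∈ Finset.range k,
      ‖w (p i) • (b (p (i + 1)) - b (p i)) - (w (p (i + 1)) • b (p (i + 1)) - w (p i) • b (p i)
        - ∫ r in p i..p (i + 1), w' r • b r)‖ ≤
      ε / (I + 1) * ∫ r in p i..p (i + 1), ‖w' r‖ := by
    intro i hi
    have hi := Finset.mem_range.1 hi
    have hwi := hw.mono_set (hsub i hi)
    have : w (p i) • (b (p (i + 1)) - b (p i)) - (w (p (i + 1)) • b (p (i + 1)) - w (p i) • b (p i)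
        - ∫ r in p i..p (i + 1), w' r • b r) =
        ∫ r in p i..p (i + 1), w' r • (b r - b (p (i + 1))) := by
      simp only [smul_sub]
      rw [intervalIntegral.integral_sub (hwb.mono_set (hsub i hi)) (hwi.smul_continuousOn continuousOn_const),
        intervalIntegral.integral_smul_const, hw' _ (hmem i hi.le) _ (hmem _ hi), sub_smul]
      abel
    rw [this, ← intervalIntegral.integral_const_mul]
    refine intervalIntegral.norm_integral_le_of_norm_le (hmono i) (ae_of_all _ fun r hr => ?_)
      (hwi.norm.const_mul _)
    rw [norm_smul, mul_comm]
    refine mul_le_mul_of_nonneg_right ?_ (norm_nonneg _)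
    rw [← dist_eq_norm]
    refine (hbδ r ⟨(hmem i hi.le).1.trans hr.1.le, hr.2.trans (hmem _ hi).2⟩ _ (hmem _ hi) ?_).le
    have hstep : p (i + 1) - p i = (t - s) / k := by
      simp only [hp]; push_cast; field_simp; ring
    rw [dist_comm, Real.dist_eq, abs_of_nonneg (sub_nonneg.2 hr.2)]
    linarith [hr.1]
  refine (norm_sum_le_of_le _ hterm).trans_lt ?_
  rw [← Finset.mul_sum, ← e4, div_mul_eq_mul_div, div_lt_iff₀ (by positivity)]
  nlinarith

theorem tendsto_riemannSum_pathIntegral (hf : IsDriftCoefficient f) (hs : s ∈ Ico (0 : ℝ) 1)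
    (ht : t ∈ Ico (0 : ℝ) 1) (hst : s ≤ t) (hb : ContinuousOn b (Ico 0 1)) :
    Tendsto (riemannSum (fun r => Real.exp (driftPrimitive f r)) b s t) atTop
      (𝓝 (pathIntegral f b s t)) := by
  have hsub : Icc s t ⊆ Ico 0 1 := by
    have := uIcc_subset_Ico_zero_one hs ht
    rwa [uIcc_of_le hst] at this
  exact tendsto_riemannSum hst (hf.intervalIntegrable_weight hs ht)
    (fun x hx y hy => hf.integral_weight (hsub hx) (hsub hy)) (hb.mono hsub)

/-- These sums are the variances of the Riemann sums of `∫ exp F dB`. The limit is the general one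
for the path `b r = r`, after which the integration by parts is undone. -/
theorem tendsto_riemannSum_clock (hf : IsDriftCoefficient f) (hs : s ∈ Ico (0 : ℝ) 1)
    (ht : t ∈ Ico (0 : ℝ) 1) (hst : s ≤ t) :
    Tendsto (riemannSum (fun r => Real.exp (2 * driftPrimitive f r)) (fun r : ℝ => r) s t) atTop
      (𝓝 (driftClock f t - driftClock f s)) := by
  have hsub : Icc s t ⊆ Ico 0 1 := by
    have := uIcc_subset_Ico_zero_one hs ht
    rwa [uIcc_of_le hst] at this
  set W : ℝ → ℝ := fun r => Real.exp (2 * driftPrimitive f r) with hW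
  set W' : ℝ → ℝ := fun r => 2 * f r * Real.exp (2 * driftPrimitive f r) with hW'
  have hcont := hf.continuousOn_exp 2
  have hint : ∀ x ∈ Ico (0 : ℝ) 1, ∀ y ∈ Ico (0 : ℝ) 1, IntervalIntegrable W' volume x y :=
    fun x hx y hy => by
      simpa [hW', mul_assoc] using (hf.intervalIntegrable_smul hx hy hcont).const_mul 2
  have hlim := tendsto_riemannSum (b := fun r : ℝ => r) (w := W) (w' := W') hst (hint s hs t ht)
    (fun x hx y hy => (hf.absolutelyContinuousOnInterval_exp 2 (hsub hx)
      (hsub hy)).integral_eq_sub_of_ae_hasDerivAt (hf.ae_hasDerivAt_exp 2 (hsub hx) (hsub hy))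
        (hint x (hsub hx) y (hsub hy))) continuousOn_id
  convert hlim using 2
  have hid : AbsolutelyContinuousOnInterval (fun r : ℝ => r) s t :=
    (LipschitzWith.id.lipschitzOnWith (s := uIcc s t)).absolutelyContinuousOnInterval
  have hcont' : ContinuousOn (fun r : ℝ => r) (uIcc s t) := continuousOn_id
  have hac : AbsolutelyContinuousOnInterval (fun r => W r * r) s t :=
    (hf.absolutelyContinuousOnInterval_exp 2 hs ht).mul hid
  have h1 : IntervalIntegrable (fun r => W' r * r) volume s t :=
    (hint s hs t ht).mul_continuousOn hcont'
  have h2 : IntervalIntegrable W volume s t := hf.intervalIntegrable_exp 2 hs ht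
  have key := hac.integral_eq_sub_of_ae_hasDerivAt (g' := fun r => W' r * r + W r) (by
      filter_upwards [hf.ae_hasDerivAt_exp 2 hs ht] with r h hr
      convert! (h hr).mul (hasDerivAt_id r) using 1
      simp [hW, hW']) (h1.add h2)
  rw [intervalIntegral.integral_add h1 h2] at key
  rw [hf.clock_sub hs ht]
  simp only [smul_eq_mul]
  linarith

/-! ### The limit of the solution at time `1` -/

/-- An approximate identity argument with `b 1` subtracted from `b`: the contribution before a fixed
`t₀` is killed by `exp(-F t) → 0`, and after `t₀` the weight is nonnegative with `exp(-F t) ∫_{t₀}^t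
f exp F ≤ 1`. The sign of `f` therefore matters only near `1`. -/
theorem tendsto_pathSolution (hf : IsDriftCoefficient f)
    (hlim : Tendsto (driftPrimitive f) (𝓝[<] 1) atTop) (hpos : ∀ᶠ t in 𝓝[<] (1 : ℝ), 0 ≤ f t)
    (hb : ContinuousOn b (Icc 0 1)) (hb0 : b 0 = 0) :
    Tendsto (pathSolution f b) (𝓝[<] 1) (𝓝 0) := by
  have h0 : (0 : ℝ) ∈ Ico (0 : ℝ) 1 := ⟨le_rfl, one_pos⟩
  have hbI : ContinuousOn b (Ico 0 1) := hb.mono Ico_subset_Icc_self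
  have hb1 : Tendsto b (𝓝[<] 1) (𝓝 (b 1)) := by
    have := hb 1 ⟨zero_le_one, le_rfl⟩
    rw [ContinuousWithinAt, nhdsWithin_Icc_eq_nhdsLE one_pos] at this
    exact this.mono_left (nhdsWithin_mono _ Iio_subset_Iic_self)
  have hexp : Tendsto (fun t => Real.exp (-driftPrimitive f t)) (𝓝[<] 1) (𝓝 0) :=
    Real.tendsto_exp_neg_atTop_nhds_zero.comp hlim
  have hd : ContinuousOn (fun r => b r - b 1) (Ico 0 1) := hbI.sub continuousOn_const
  rw [Metric.tendsto_nhds]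
  intro ε hε
  have hnear : ∀ᶠ r in 𝓝[<] (1 : ℝ), 0 ≤ f r ∧ ‖b r - b 1‖ ≤ ε / 2 := by
    refine hpos.and ?_
    filter_upwards [Metric.tendsto_nhds.1 hb1 (ε / 2) (half_pos hε)] with r hr
    rw [← dist_eq_norm]
    exact hr.le
  obtain ⟨u, hu, hnear⟩ := (mem_nhdsLT_iff_exists_Ioo_subset' (one_pos (α := ℝ))).1
    (hnear.and Ico_mem_nhdsLT_one)
  obtain ⟨t₀, hut₀, ht₀⟩ := exists_between (mem_Iio.1 hu)
  replace hnear := (Ico_subset_Ioo_left hut₀).trans hnear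
  have ht₀' : t₀ ∈ Ico (0 : ℝ) 1 := (hnear ⟨le_rfl, ht₀⟩).2
  -- The contribution of times before `t₀`, a constant independent of `t`.
  set C := ∫ r in (0 : ℝ)..t₀, driftWeight f r • (b r - b 1)
  have hsmall : Tendsto (fun t => (b t - b 1) + Real.exp (-driftPrimitive f t) • (b 1 - C))
      (𝓝[<] 1) (𝓝 0) := by
    simpa using (hb1.sub_const (b 1)).add (hexp.smul_const (b 1 - C))
  filter_upwards [Metric.tendsto_nhds.1 hsmall (ε / 2) (half_pos hε),
    Ico_mem_nhdsLT ht₀] with t hsm ht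
  have ht' : t ∈ Ico (0 : ℝ) 1 := ⟨ht₀'.1.trans ht.1, ht.2⟩
  have hrest : ‖∫ r in t₀..t, driftWeight f r • (b r - b 1)‖
      ≤ ε / 2 * Real.exp (driftPrimitive f t) := by
    refine (intervalIntegral.norm_integral_le_of_norm_le ht.1 (ae_of_all _ fun r hr => ?_)
      ((hf.intervalIntegrable_weight ht₀' ht').const_mul (ε / 2))).trans ?_
    · have hr' := (hnear ⟨hr.1.le, hr.2.trans_lt ht.2⟩).1
      have hw : 0 ≤ driftWeight f r := mul_nonneg hr'.1 (Real.exp_pos _).le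
      rw [norm_smul, Real.norm_of_nonneg hw, mul_comm]
      exact mul_le_mul_of_nonneg_right hr'.2 hw
    · rw [intervalIntegral.integral_const_mul, hf.integral_weight ht₀' ht']
      have := Real.exp_pos (driftPrimitive f t₀)
      nlinarith
  have hdecomp : pathSolution f b t = ((b t - b 1) + Real.exp (-driftPrimitive f t) • (b 1 - C))
      - Real.exp (-driftPrimitive f t) • ∫ r in t₀..t, driftWeight f r • (b r - b 1) := by
    have h1 : ∫ r in (0 : ℝ)..t, driftWeight f r • b r
        = (C + ∫ r in t₀..t, driftWeight f r • (b r - b 1))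
          + (Real.exp (driftPrimitive f t) - 1) • b 1 := by
      rw [intervalIntegral.integral_add_adjacent_intervals
        (hf.intervalIntegrable_weight_smul h0 ht₀' hd)
        (hf.intervalIntegrable_weight_smul ht₀' ht' hd)]
      simp only [smul_sub]
      rw [intervalIntegral.integral_sub (hf.intervalIntegrable_weight_smul h0 ht' hbI)
        (hf.intervalIntegrable_weight_smul h0 ht' continuousOn_const),
        intervalIntegral.integral_smul_const, hf.integral_weight h0 ht']
      simp [driftPrimitive]
    rw [pathSolution_eq hb0, h1]
    have h2 : Real.exp (-driftPrimitive f t) • (Real.exp (driftPrimitive f t) - 1) • b 1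
        = b 1 - Real.exp (-driftPrimitive f t) • b 1 := by
      rw [smul_smul, mul_sub, ← Real.exp_add, neg_add_cancel, Real.exp_zero, mul_one, sub_smul,
        one_smul]
    rw [smul_add, smul_add, h2, smul_sub]
    abel
  rw [dist_zero_right] at hsm ⊢
  rw [hdecomp]
  refine (norm_sub_le _ _).trans_lt ?_
  have : ‖Real.exp (-driftPrimitive f t) • ∫ r in t₀..t, driftWeight f r • (b r - b 1)‖
      ≤ ε / 2 := by
    rw [norm_smul, Real.norm_of_nonneg (Real.exp_pos _).le]
    calc _ ≤ Real.exp (-driftPrimitive f t) * (ε / 2 * Real.exp (driftPrimitive f t)) :=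
          mul_le_mul_of_nonneg_left hrest (Real.exp_pos _).le
      _ = ε / 2 := by rw [mul_left_comm, ← Real.exp_add]; simp
  linarith

end VariationOfConstants

/-! ### The density of the standard Gaussian measure and Stein's identity -/

section Gaussian

variable {V : Type*} [NormedAddCommGroup V] [InnerProductSpace ℝ V]

variable (V) in
/-- The density of the standard Gaussian measure of a Euclidean space. -/
noncomputable def stdGaussianDensity (z : V) : ℝ :=
  (2 * Real.pi) ^ (-(Module.finrank ℝ V / 2 : ℝ)) * Real.exp (-(1 / 2) * ‖z‖ ^ 2)

theorem stdGaussianDensity_nonneg (z : V) : 0 ≤ stdGaussianDensity V z := by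
  unfold stdGaussianDensity; positivity

theorem contDiff_stdGaussianDensity : ContDiff ℝ 1 (stdGaussianDensity V) :=
  contDiff_const.mul ((contDiff_const.mul (contDiff_norm_sq ℝ)).exp)

theorem fderiv_stdGaussianDensity (z v : V) :
    fderiv ℝ (stdGaussianDensity V) z v = -(stdGaussianDensity V z * inner ℝ z v) := by
  have h := (((hasStrictFDerivAt_norm_sq z).hasFDerivAt.const_mul (-(1 / 2 : ℝ))).exp.const_mul
    ((2 * Real.pi) ^ (-(Module.finrank ℝ V / 2 : ℝ)))).fderiv
  have h' : fderiv ℝ (stdGaussianDensity V) z = _ := h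
  rw [h']
  simp [stdGaussianDensity]
  ring

variable [FiniteDimensional ℝ V] [MeasurableSpace V] [BorelSpace V]

/-- Both measures are finite and have the same characteristic function, by the Gaussian Fourier
integral. The density is needed for integration by parts against Lebesgue measure. -/
theorem stdGaussian_eq_withDensity :
    stdGaussian V = volume.withDensity (fun z => ENNReal.ofReal (stdGaussianDensity V z)) := by
  have hint : Integrable (stdGaussianDensity V) := by
    have h := (GaussianFourier.integrable_cexp_neg_mul_sq_norm_add (V := V) (b := 1 / 2) (by norm_num) 0 0).norm
    refine (h.congr (ae_of_all _ fun z => ?_)).const_mul _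
    simp only [Complex.norm_exp]
    norm_num [← Complex.ofReal_pow]
  have : IsFiniteMeasure (volume.withDensity
      (fun z => ENNReal.ofReal (stdGaussianDensity V z))) :=
    isFiniteMeasure_withDensity_ofReal hint.2
  refine Measure.ext_of_charFun ?_
  ext t
  rw [charFun_stdGaussian, charFun_apply, integral_withDensity_eq_integral_toReal_smul
    (by
      have := (contDiff_stdGaussianDensity (V := V)).continuous
      fun_prop) (ae_of_all _ fun _ => ENNReal.ofReal_lt_top)]
  have key := GaussianFourier.integral_cexp_neg_mul_sq_norm_add (V := V) (b := 1 / 2) (by norm_num) Complex.I t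
  have h2 : ∀ z : V, (ENNReal.ofReal (stdGaussianDensity V z)).toReal •
      Complex.exp (inner ℝ z t * Complex.I)
      = (((2 * Real.pi) ^ (-(Module.finrank ℝ V / 2 : ℝ)) : ℝ) : ℂ) *
        Complex.exp (-(1 / 2) * ‖z‖ ^ 2 + Complex.I * inner ℝ t z) := fun z => by
    rw [ENNReal.toReal_ofReal (stdGaussianDensity_nonneg z), stdGaussianDensity, Complex.real_smul,
      Complex.exp_add, real_inner_comm, mul_comm Complex.I]
    push_cast
    ring
  simp_rw [h2]
  rw [integral_const_mul, key, ← mul_assoc]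
  have h3 : (((2 * Real.pi) ^ (-(Module.finrank ℝ V / 2 : ℝ)) : ℝ) : ℂ) *
      (Real.pi / (1 / 2)) ^ (Module.finrank ℝ V / 2 : ℂ) = 1 := by
    have e : (Real.pi / (1 / 2) : ℂ) = ((2 * Real.pi : ℝ) : ℂ) := by push_cast; ring
    have e2 : (Module.finrank ℝ V / 2 : ℂ) = ((Module.finrank ℝ V / 2 : ℝ) : ℂ) := by push_cast; rfl
    rw [e, e2, ← Complex.ofReal_cpow (by positivity), ← Complex.ofReal_mul,
      ← Real.rpow_add (by positivity)]
    simp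
  rw [h3, one_mul]
  congr 1
  simp
  ring

theorem integral_stdGaussian (h : V → ℝ) :
    ∫ z, h z ∂(stdGaussian V) = ∫ z, stdGaussianDensity V z * h z := by
  rw [stdGaussian_eq_withDensity, integral_withDensity_eq_integral_toReal_smul
    (by
      have := (contDiff_stdGaussianDensity (V := V)).continuous
      fun_prop) (ae_of_all _ fun _ => ENNReal.ofReal_lt_top)]
  simp [ENNReal.toReal_ofReal (stdGaussianDensity_nonneg _)]

theorem integrable_stdGaussian_iff (h : V → ℝ) :
    Integrable h (stdGaussian V) ↔ Integrable (fun z => stdGaussianDensity V z * h z) := by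
  rw [stdGaussian_eq_withDensity, integrable_withDensity_iff_integrable_smul'
    (by
      have := (contDiff_stdGaussianDensity (V := V)).continuous
      fun_prop) (ae_of_all _ fun _ => ENNReal.ofReal_lt_top)]
  simp [ENNReal.toReal_ofReal (stdGaussianDensity_nonneg _)]

/-- Gaussian integration by parts. -/
theorem integral_inner_mul_stdGaussian {g : V → ℝ} (hg : ContDiff ℝ 1 g) {C D : ℝ}
    (hC : ∀ z, ‖g z‖ ≤ C) (hD : ∀ z, ‖fderiv ℝ g z‖ ≤ D) (v : V) :
    ∫ z, inner ℝ z v * g z ∂(stdGaussian V) = ∫ z, fderiv ℝ g z v ∂(stdGaussian V) := by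
  have hid : Integrable (fun z : V => inner ℝ z v) (stdGaussian V) :=
    IsGaussian.integrable_id.inner_const v
  have hgm : AEStronglyMeasurable g (stdGaussian V) := hg.continuous.aestronglyMeasurable
  have i1 : Integrable (fun z => inner ℝ z v * g z) (stdGaussian V) := by
    simpa [mul_comm] using hid.bdd_mul hgm (ae_of_all _ hC)
  have i2 : Integrable (fun z => fderiv ℝ g z v) (stdGaussian V) := by
    refine Integrable.of_bound
      ((hg.continuous_fderiv one_ne_zero).clm_apply continuous_const).aestronglyMeasurable
      (D * ‖v‖) (ae_of_all _ fun z => ?_)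
    exact (ContinuousLinearMap.le_opNorm _ _).trans
      (mul_le_mul_of_nonneg_right (hD z) (norm_nonneg _))
  have i3 : Integrable g (stdGaussian V) := Integrable.of_bound hgm C (ae_of_all _ hC)
  rw [integrable_stdGaussian_iff] at i1 i2 i3
  rw [integral_stdGaussian, integral_stdGaussian,
    integral_mul_fderiv_eq_neg_fderiv_mul_of_integrable _ i2 i3
      (fun z _ => (contDiff_stdGaussianDensity.differentiable one_ne_zero) z)
      (fun z _ => (hg.differentiable one_ne_zero) z), ← integral_neg]
  · refine integral_congr_ae (ae_of_all _ fun z => ?_)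
    simp only [fderiv_stdGaussianDensity]
    ring
  · simpa [fderiv_stdGaussianDensity, mul_assoc] using i1.neg

end Gaussian

/-! ### Gaussian means of test functions -/

section GaussianMean

theorem exists_bound_of_compactSupport {X W : Type*} [TopologicalSpace X] [Nonempty X]
    [NormedAddCommGroup W] {g : X → W}
    (hg : Continuous g) (hc : HasCompactSupport g) : ∃ C, 0 ≤ C ∧ ∀ z, ‖g z‖ ≤ C := by
  obtain ⟨C, hC⟩ := hc.exists_bound_of_continuous hg
  exact ⟨C, (norm_nonneg _).trans (hC (Classical.arbitrary X)), hC⟩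

variable {V : Type*} [NormedAddCommGroup V] [InnerProductSpace ℝ V] {φ : V → ℝ}

/-- The derivative of `p ↦ p.1 • x + p.2 • z`. -/
noncomputable def affineDirection (x z : V) : ℝ × ℝ →L[ℝ] V :=
  (ContinuousLinearMap.fst ℝ ℝ ℝ).smulRight x + (ContinuousLinearMap.snd ℝ ℝ ℝ).smulRight z

theorem affineDirection_apply (x z : V) (r : ℝ × ℝ) :
    affineDirection x z r = r.1 • x + r.2 • z := rfl

theorem norm_affineDirection_le (x z : V) : ‖affineDirection x z‖ ≤ ‖x‖ + ‖z‖ := by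
  refine ContinuousLinearMap.opNorm_le_bound _ (by positivity) fun r => ?_
  rw [affineDirection_apply]
  refine (norm_add_le _ _).trans ?_
  rw [norm_smul, norm_smul, add_mul, mul_comm ‖x‖, mul_comm ‖z‖]
  gcongr
  · exact norm_fst_le r
  · exact norm_snd_le r

theorem continuous_affineDirection (x : V) : Continuous (affineDirection x) :=
  continuous_const.add (ContinuousLinearMap.smulRightL ℝ (ℝ × ℝ) V
    (ContinuousLinearMap.snd ℝ ℝ ℝ)).continuous

theorem hasFDerivAt_affine (x z : V) (q : ℝ × ℝ) :
    HasFDerivAt (fun p : ℝ × ℝ => p.1 • x + p.2 • z) (affineDirection x z) q :=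
  (hasFDerivAt_fst.smul_const x).add (hasFDerivAt_snd.smul_const z)

variable [FiniteDimensional ℝ V]

theorem laplacian_eq_sum (φ : V → ℝ) (y : V) :
    Laplacian.laplacian φ y = ∑ i, fderiv ℝ (fderiv ℝ φ) y (stdOrthonormalBasis ℝ V i)
      (stdOrthonormalBasis ℝ V i) := by
  have h := congrFun (InnerProductSpace.laplacian_eq_iteratedFDeriv_stdOrthonormalBasis φ) y
  simpa [iteratedFDeriv_two_apply] using h

theorem continuous_laplacian (hφ : ContDiff ℝ 2 φ) : Continuous (Laplacian.laplacian φ) := by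
  have h : Continuous (fderiv ℝ (fderiv ℝ φ)) :=
    (hφ.fderiv_right (m := 1) (by norm_num)).continuous_fderiv one_ne_zero
  have e : Laplacian.laplacian φ = fun y => ∑ i, fderiv ℝ (fderiv ℝ φ) y
      (stdOrthonormalBasis ℝ V i) (stdOrthonormalBasis ℝ V i) := funext (laplacian_eq_sum φ)
  rw [e]
  fun_prop

theorem hasCompactSupport_laplacian (hc : HasCompactSupport φ) :
    HasCompactSupport (Laplacian.laplacian φ) := by
  have h : HasCompactSupport (fderiv ℝ (fderiv ℝ φ)) := (hc.fderiv ℝ).fderiv ℝ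
  exact h.mono' fun y hy => subset_tsupport _ (by
    contrapose! hy
    rw [Function.notMem_support] at hy ⊢
    simp [laplacian_eq_sum, hy])

variable [MeasurableSpace V] [BorelSpace V]

/-- `E g (c x + σ Z)` for a standard Gaussian vector `Z`. -/
noncomputable def gaussianMean (g : V → ℝ) (x : V) (p : ℝ × ℝ) : ℝ :=
  ∫ z, g (p.1 • x + p.2 • z) ∂(stdGaussian V)

theorem continuous_gaussianMean {g : V → ℝ} (hg : Continuous g) {C : ℝ} (hC : ∀ z, ‖g z‖ ≤ C)
    (x : V) : Continuous (gaussianMean g x) :=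
  continuous_of_dominated (fun p => Continuous.aestronglyMeasurable (by fun_prop))
    (fun p => ae_of_all _ fun z => hC _) (integrable_const C) (ae_of_all _ fun z => by fun_prop)

theorem integrable_comp_affine {g : V → ℝ} (hg : Continuous g) {C : ℝ} (hC : ∀ z, ‖g z‖ ≤ C)
    (x : V) (σ : ℝ) : Integrable (fun z => g (x + σ • z)) (stdGaussian V) :=
  Integrable.of_bound (Continuous.aestronglyMeasurable (by fun_prop)) C (ae_of_all _ fun z => hC _)

theorem integrable_fderiv_apply (hφ : ContDiff ℝ 1 φ) {D : ℝ} (hD : ∀ z, ‖fderiv ℝ φ z‖ ≤ D)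
    (x y : V) (σ : ℝ) :
    Integrable (fun z => fderiv ℝ φ (x + σ • z) y) (stdGaussian V) ∧
    Integrable (fun z => fderiv ℝ φ (x + σ • z) z) (stdGaussian V) := by
  have hc := hφ.continuous_fderiv one_ne_zero
  have hle : ∀ z w, ‖fderiv ℝ φ (x + σ • z) w‖ ≤ D * ‖w‖ := fun z w =>
    (ContinuousLinearMap.le_opNorm _ _).trans (mul_le_mul_of_nonneg_right (hD _) (norm_nonneg _))
  exact ⟨Integrable.of_bound (Continuous.aestronglyMeasurable (by fun_prop)) (D * ‖y‖)
    (ae_of_all _ fun z => hle z y), Integrable.mono'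
      ((IsGaussian.integrable_id (μ := stdGaussian V)).norm.const_mul D)
      (Continuous.aestronglyMeasurable (by fun_prop)) (ae_of_all _ fun z => hle z z)⟩

/-- Gaussian integration by parts for the radial derivative. -/
theorem integral_fderiv_apply_self (hφ : ContDiff ℝ 2 φ) (hc : HasCompactSupport φ) (x : V)
    (σ : ℝ) : ∫ z, fderiv ℝ φ (x + σ • z) z ∂(stdGaussian V)
      = σ * ∫ z, Laplacian.laplacian φ (x + σ • z) ∂(stdGaussian V) := by
  set e := stdOrthonormalBasis ℝ V
  have hφ1 : ContDiff ℝ 1 (fderiv ℝ φ) := hφ.fderiv_right (by norm_num)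
  have hφ2 := hφ1.continuous_fderiv one_ne_zero
  obtain ⟨D, hD0, hD⟩ := exists_bound_of_compactSupport hφ1.continuous (hc.fderiv ℝ)
  obtain ⟨H, hH0, hH⟩ := exists_bound_of_compactSupport hφ2 ((hc.fderiv ℝ).fderiv ℝ)
  have hder : ∀ i z, HasFDerivAt (fun z => fderiv ℝ φ (x + σ • z) (e i))
      (σ • (fderiv ℝ (fderiv ℝ φ) (x + σ • z)).flip (e i)) z := fun i z => by
    have h1 : HasFDerivAt (fun z : V => x + σ • z) (σ • ContinuousLinearMap.id ℝ V) z :=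
      ((hasFDerivAt_id z).const_smul σ).const_add x
    have h2 := ((hφ1.differentiable one_ne_zero (x + σ • z)).hasFDerivAt.comp z h1).clm_apply
      (hasFDerivAt_const (e i) z)
    convert! h2 using 1
    ext w
    simp
  -- Integration by parts in the direction `e i`; the chain rule through `x + σ • z` supplies the
  -- factor `σ`.
  have hstein : ∀ i, ∫ z, inner ℝ z (e i) * fderiv ℝ φ (x + σ • z) (e i) ∂(stdGaussian V)
      = ∫ z, σ * fderiv ℝ (fderiv ℝ φ) (x + σ • z) (e i) (e i) ∂(stdGaussian V) := fun i => by
    rw [integral_inner_mul_stdGaussian (C := D) (D := |σ| * H)]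
    · simp [(hder i _).fderiv]
    · fun_prop
    · intro z
      simpa [e.norm_eq_one] using ((fderiv ℝ φ (x + σ • z)).le_opNorm (e i)).trans
        (mul_le_mul_of_nonneg_right (hD _) (norm_nonneg _))
    · intro z
      rw [(hder i z).fderiv, norm_smul, Real.norm_eq_abs]
      refine mul_le_mul_of_nonneg_left ?_ (abs_nonneg _)
      refine ((ContinuousLinearMap.le_opNorm _ _).trans_eq ?_).trans (hH (x + σ • z))
      rw [e.norm_eq_one, mul_one, ContinuousLinearMap.opNorm_flip]
  have hexp : ∀ z, fderiv ℝ φ (x + σ • z) z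
      = ∑ i, inner ℝ z (e i) * fderiv ℝ φ (x + σ • z) (e i) := fun z => by
    have h := congrArg (fderiv ℝ φ (x + σ • z)) (e.sum_repr' z)
    rw [map_sum] at h
    simpa [real_inner_comm] using h.symm
  simp_rw [hexp]
  rw [integral_finsetSum]
  · simp_rw [hstein]
    rw [← integral_finsetSum, ← integral_const_mul]
    · simp_rw [laplacian_eq_sum, Finset.mul_sum]
      rfl
    · intro i _
      refine (Integrable.of_bound (Continuous.aestronglyMeasurable (by fun_prop)) H
        (ae_of_all _ fun z => ?_)).const_mul σ
      refine ((ContinuousLinearMap.le_opNorm _ _).trans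
        (mul_le_mul_of_nonneg_right (ContinuousLinearMap.le_opNorm _ _) (norm_nonneg _))).trans ?_
      simpa [e.norm_eq_one] using hH _
  · intro i _
    have hid : Integrable (fun z : V => inner ℝ z (e i)) (stdGaussian V) :=
      IsGaussian.integrable_id.inner_const (e i)
    have := hid.bdd_mul (c := D) (f := fun z => fderiv ℝ φ (x + σ • z) (e i))
      (Continuous.aestronglyMeasurable (by fun_prop)) (ae_of_all _ fun z => by
      simpa [e.norm_eq_one] using ((fderiv ℝ φ (x + σ • z)).le_opNorm (e i)).trans
        (mul_le_mul_of_nonneg_right (hD _) (norm_nonneg _)))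
    simpa [mul_comm] using this

theorem integrable_fderiv_comp_affineDirection (hφ : ContDiff ℝ 1 φ) {D : ℝ}
    (hD : ∀ z, ‖fderiv ℝ φ z‖ ≤ D) (x : V) (p : ℝ × ℝ) :
    Integrable (fun z => (fderiv ℝ φ (p.1 • x + p.2 • z)).comp (affineDirection x z))
      (stdGaussian V) := by
  have hφ1 := hφ.continuous_fderiv one_ne_zero
  refine Integrable.mono' (g := fun z => D * (‖x‖ + ‖z‖))
    (((integrable_const _).add IsGaussian.integrable_id.norm).const_mul D)
    (Continuous.aestronglyMeasurable (Continuous.clm_comp (by fun_prop)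
      (continuous_affineDirection x))) (ae_of_all _ fun z => ?_)
  exact (ContinuousLinearMap.opNorm_comp_le _ _).trans (mul_le_mul (hD _)
    (norm_affineDirection_le x z) (norm_nonneg _) ((norm_nonneg _).trans (hD 0)))

theorem hasFDerivAt_gaussianMean (hφ : ContDiff ℝ 1 φ) (hc : HasCompactSupport φ) (x : V)
    (p : ℝ × ℝ) :
    HasFDerivAt (gaussianMean φ x) (∫ z, (fderiv ℝ φ (p.1 • x + p.2 • z)).comp
      (affineDirection x z) ∂(stdGaussian V)) p := by
  have hφ1 := hφ.continuous_fderiv one_ne_zero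
  obtain ⟨C, -, hC⟩ := exists_bound_of_compactSupport hφ.continuous hc
  obtain ⟨D, hD0, hD⟩ := exists_bound_of_compactSupport hφ1 (hc.fderiv ℝ)
  refine hasFDerivAt_integral_of_dominated_of_fderiv_le (s := univ)
    (F := fun p z => φ (p.1 • x + p.2 • z))
    (F' := fun p z => (fderiv ℝ φ (p.1 • x + p.2 • z)).comp (affineDirection x z))
    (bound := fun z => D * (‖x‖ + ‖z‖)) univ_mem
    (Eventually.of_forall fun p => (integrable_comp_affine hφ.continuous hC _ _).1)
    (integrable_comp_affine hφ.continuous hC _ _)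
    (integrable_fderiv_comp_affineDirection hφ hD x p).1
    (ae_of_all _ fun z q _ => (ContinuousLinearMap.opNorm_comp_le _ _).trans (mul_le_mul (hD _)
      (norm_affineDirection_le x z) (norm_nonneg _) hD0))
    (((integrable_const _).add IsGaussian.integrable_id.norm).const_mul D)
    (ae_of_all _ fun z q _ => ?_)
  exact (hφ.differentiable one_ne_zero _).hasFDerivAt.comp q (hasFDerivAt_affine x z q)

/-- Only the derivative in the direction `z` is turned into a Laplacian. The term in the direction
`x` is kept, since it later recombines into the radial derivative. -/
theorem HasDerivAt.gaussianMean (hφ : ContDiff ℝ 2 φ) (hc : HasCompactSupport φ) (x : V)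
    {c σ : ℝ → ℝ} {c' σ' t : ℝ} (hc' : HasDerivAt c c' t) (hσ' : HasDerivAt σ σ' t) :
    HasDerivAt (fun t => gaussianMean φ x (c t, σ t))
      (c' * (∫ z, fderiv ℝ φ (c t • x + σ t • z) x ∂(stdGaussian V))
        + σ' * (σ t * gaussianMean (Laplacian.laplacian φ) x (c t, σ t))) t := by
  have hφ1 : ContDiff ℝ 1 φ := hφ.of_le (by norm_num)
  obtain ⟨D, hD0, hD⟩ := exists_bound_of_compactSupport (hφ1.continuous_fderiv one_ne_zero)
    (hc.fderiv ℝ)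
  have h := (hasFDerivAt_gaussianMean hφ1 hc x (c t, σ t)).comp_hasDerivAt t (hc'.prodMk hσ')
  obtain ⟨i1, i2⟩ := integrable_fderiv_apply hφ1 hD (c t • x) x (σ t)
  convert! h using 1
  rw [ContinuousLinearMap.integral_apply (integrable_fderiv_comp_affineDirection hφ1 hD x _)]
  simp only [ContinuousLinearMap.comp_apply, affineDirection_apply, map_add, map_smul, smul_eq_mul]
  rw [integral_add (i1.const_mul _) (i2.const_mul _), integral_const_mul, integral_const_mul,
    integral_fderiv_apply_self hφ hc]
  rfl

/-- With `AbsolutelyContinuousOnInterval.of_dist_le` this makes the mean absolutely continuous along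
absolutely continuous curves of scale and standard deviation. -/
theorem dist_gaussianMean_le {g : V → ℝ} {K : ℝ≥0} (hg : LipschitzWith K g) {C : ℝ}
    (hC : ∀ z, ‖g z‖ ≤ C) (x : V) (p q : ℝ × ℝ) :
    dist (gaussianMean g x p) (gaussianMean g x q) ≤
      K * ‖x‖ * dist p.1 q.1 + K * (∫ z, ‖z‖ ∂(stdGaussian V)) * dist p.2 q.2 := by
  have hid : Integrable (fun z : V => ‖z‖) (stdGaussian V) := IsGaussian.integrable_id.norm
  rw [dist_eq_norm, gaussianMean, gaussianMean,
    ← integral_sub (integrable_comp_affine hg.continuous hC _ _)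
      (integrable_comp_affine hg.continuous hC _ _)]
  refine (norm_integral_le_of_norm_le (((integrable_const (K * ‖x‖ * dist p.1 q.1)).add
    ((hid.const_mul K).mul_const (dist p.2 q.2)))) (ae_of_all _ fun z => ?_)).trans_eq ?_
  · rw [← dist_eq_norm]
    refine (hg.dist_le_mul _ _).trans ?_
    simp only [Pi.add_apply]
    rw [mul_assoc, mul_assoc, ← mul_add]
    refine mul_le_mul_of_nonneg_left ?_ K.2
    refine (dist_add_add_le _ _ _ _).trans_eq ?_
    rw [dist_eq_norm, ← sub_smul, norm_smul, dist_eq_norm, ← sub_smul, norm_smul,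
      Real.dist_eq, Real.dist_eq, Real.norm_eq_abs, Real.norm_eq_abs]
    ring
  · rw [integral_add' (integrable_const _) ((hid.const_mul _).mul_const _)]
    simp [integral_mul_const, integral_const_mul]

end GaussianMean

/-! ### The generator of the Gaussian transition semigroup -/

section Generator

/-- The contraction factor of the transition from time `s` to time `t`. -/
noncomputable def transitionScale (f : ℝ → ℝ) (s t : ℝ) : ℝ :=
  Real.exp (driftPrimitive f s - driftPrimitive f t)

/-- The standard deviation of the transition from time `s` to time `t`. -/
noncomputable def transitionNoise (f : ℝ → ℝ) (s t : ℝ) : ℝ :=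
  Real.exp (-driftPrimitive f t) * √(driftClock f t - driftClock f s)

variable {f : ℝ → ℝ} {s t : ℝ}

theorem transitionScale_self (s : ℝ) : transitionScale f s s = 1 := by simp [transitionScale]

theorem transitionNoise_self (s : ℝ) : transitionNoise f s s = 0 := by simp [transitionNoise]

theorem continuousOn_transitionScale (hf : IsDriftCoefficient f) (s : ℝ) :
    ContinuousOn (transitionScale f s) (Ico 0 1) :=
  (continuousOn_const.sub hf.continuousOn_primitive).rexp

theorem continuousOn_transitionNoise (hf : IsDriftCoefficient f) (s : ℝ) :
    ContinuousOn (transitionNoise f s) (Ico 0 1) :=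
  hf.continuousOn_primitive.neg.rexp.mul (hf.continuousOn_clock.sub continuousOn_const).sqrt

theorem hasDerivAt_transitionScale {r : ℝ} (h : HasDerivAt (driftPrimitive f) (f r) r) :
    HasDerivAt (transitionScale f s) (-f r * transitionScale f s r) r := by
  have := (h.const_sub (driftPrimitive f s)).exp
  rw [mul_comm] at this
  exact this

theorem hasDerivAt_transitionNoise (hf : IsDriftCoefficient f) {r : ℝ} (hs : s ∈ Ico (0 : ℝ) 1)
    (hsr : s < r) (hr : r < 1) (h : HasDerivAt (driftPrimitive f) (f r) r) :
    HasDerivAt (transitionNoise f s) (-f r * transitionNoise f s r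
      + Real.exp (driftPrimitive f r) / (2 * √(driftClock f r - driftClock f s))) r := by
  have hr0 : 0 < r := hs.1.trans_lt hsr
  have hpos : 0 < driftClock f r - driftClock f s :=
    sub_pos.2 (hf.clock_lt hs ⟨hr0.le, hr⟩ hsr)
  have h2 := h.neg.exp.mul (((hf.hasDerivAt_clock ⟨hr0, hr⟩).sub_const (driftClock f s)).sqrt hpos.ne')
  convert! h2 using 1
  have e : Real.exp (driftPrimitive f r)
      = Real.exp (-driftPrimitive f r) * Real.exp (2 * driftPrimitive f r) := by
    rw [← Real.exp_add]
    congr 1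
    ring
  rw [transitionNoise, e]
  simp only [Pi.neg_apply]
  ring

theorem absolutelyContinuousOnInterval_transitionScale (hf : IsDriftCoefficient f)
    {a b : ℝ} (ha : a ∈ Ico (0 : ℝ) 1) (hb : b ∈ Ico (0 : ℝ) 1) :
    AbsolutelyContinuousOnInterval (transitionScale f s) a b :=
  ContDiff.comp_absolutelyContinuousOnInterval
    (φ := fun x => Real.exp (driftPrimitive f s - x)) (by fun_prop)
    (hf.absolutelyContinuousOnInterval ha hb)

/-- The interval starts strictly after `s`: there the clock increment is bounded away from `0`,
where the square root is not Lipschitz. -/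
theorem absolutelyContinuousOnInterval_transitionNoise (hf : IsDriftCoefficient f)
    {a b : ℝ} (hs : s ∈ Ico (0 : ℝ) 1) (ha : s < a) (hab : a ≤ b) (hb : b < 1) :
    AbsolutelyContinuousOnInterval (transitionNoise f s) a b := by
  have ha' : a ∈ Ico (0 : ℝ) 1 := ⟨hs.1.trans ha.le, hab.trans_lt hb⟩
  have hb' : b ∈ Ico (0 : ℝ) 1 := ⟨ha'.1.trans hab, hb⟩
  refine (ContDiff.comp_absolutelyContinuousOnInterval (φ := fun x => Real.exp (-x)) (by fun_prop)
    (hf.absolutelyContinuousOnInterval ha' hb')).mul ?_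
  have hclock : AbsolutelyContinuousOnInterval (driftClock f) a b := by
    refine ((hf.intervalIntegrable_exp 2 ⟨le_rfl, one_pos⟩
      hb').absolutelyContinuousOnInterval_primitive left_mem_uIcc).mono ?_
    rw [uIcc_of_le hab, uIcc_of_le hb'.1]
    exact Icc_subset_Icc_left ha'.1
  have hpos : 0 < driftClock f a - driftClock f s := sub_pos.2 (hf.clock_lt hs ha' ha)
  obtain ⟨K, hK⟩ := (ContDiffOn.exists_lipschitzOnWith (f := fun v => √(v - driftClock f s))
    (s := Icc (driftClock f a) (driftClock f b)) (n := 1) (fun v hv => by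
      refine (ContDiffAt.sqrt (by fun_prop) ?_).contDiffWithinAt
      linarith [hv.1]) one_ne_zero (convex_Icc _ _) isCompact_Icc)
  refine hK.comp_absolutelyContinuousOnInterval (fun x hx => ?_) hclock
  rw [uIcc_of_le hab] at hx
  have hx' : x ∈ Ico (0 : ℝ) 1 := ⟨ha'.1.trans hx.1, hx.2.trans_lt hb⟩
  exact ⟨hf.clock_mono ha' hx' hx.1, hf.clock_mono hx' hb' hx.2⟩

variable {V : Type*} [NormedAddCommGroup V] [InnerProductSpace ℝ V] {φ : V → ℝ}

/-- The derivative of `φ` in the direction of the position vector. -/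
noncomputable def radialDeriv (φ : V → ℝ) (x : V) : ℝ := fderiv ℝ φ x x

theorem continuous_radialDeriv (hφ : ContDiff ℝ 1 φ) : Continuous (radialDeriv φ) :=
  (hφ.continuous_fderiv one_ne_zero).clm_apply continuous_id

theorem hasCompactSupport_radialDeriv (hc : HasCompactSupport φ) :
    HasCompactSupport (radialDeriv φ) :=
  (hc.fderiv ℝ).mono' fun x hx => subset_tsupport _ (by
    contrapose! hx
    rw [Function.notMem_support] at hx ⊢
    simp [radialDeriv, hx])

variable [FiniteDimensional ℝ V] [MeasurableSpace V] [BorelSpace V]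

/-- The mean of `g` under the transition from `x` at time `s` to time `t`. -/
noncomputable def transitionMean (f : ℝ → ℝ) (g : V → ℝ) (s : ℝ) (x : V) (t : ℝ) : ℝ :=
  gaussianMean g x (transitionScale f s t, transitionNoise f s t)

theorem transitionMean_self (g : V → ℝ) (s : ℝ) (x : V) : transitionMean f g s x s = g x := by
  simp [transitionMean, gaussianMean, transitionScale_self, transitionNoise_self]

theorem continuousOn_transitionMean (hf : IsDriftCoefficient f) {g : V → ℝ} (hg : Continuous g)
    (hc : HasCompactSupport g) (s : ℝ) (x : V) :
    ContinuousOn (transitionMean f g s x) (Ico 0 1) := by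
  obtain ⟨C, -, hC⟩ := exists_bound_of_compactSupport hg hc
  exact (continuous_gaussianMean hg hC x).comp_continuousOn
    ((continuousOn_transitionScale hf s).prodMk (continuousOn_transitionNoise hf s))

/-- At `w = c x + σ Z`, the mean of the radial derivative is `c E[dφ(w) x] + σ² E[Δφ(w)]`. The `-f
c` in `c'` and the `-f σ` in `σ'` thus assemble into the drift term, and the rest of `σ σ'` is
`1/2`. -/
theorem hasDerivAt_transitionMean (hf : IsDriftCoefficient f) (hφ : ContDiff ℝ 2 φ)
    (hc : HasCompactSupport φ) {r : ℝ} (hs : s ∈ Ico (0 : ℝ) 1) (hsr : s < r) (hr : r < 1)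
    (h : HasDerivAt (driftPrimitive f) (f r) r) (x : V) :
    HasDerivAt (transitionMean f φ s x) (1 / 2 * transitionMean f (Laplacian.laplacian φ) s x r
      - f r * transitionMean f (radialDeriv φ) s x r) r := by
  have hφ1 : ContDiff ℝ 1 φ := hφ.of_le (by norm_num)
  obtain ⟨D, hD0, hD⟩ := exists_bound_of_compactSupport (hφ1.continuous_fderiv one_ne_zero)
    (hc.fderiv ℝ)
  have hpos : 0 < driftClock f r - driftClock f s :=
    sub_pos.2 (hf.clock_lt hs ⟨hs.1.trans hsr.le, hr⟩ hsr)
  have key := HasDerivAt.gaussianMean hφ hc x (hasDerivAt_transitionScale (s := s) h)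
    (hasDerivAt_transitionNoise hf hs hsr hr h)
  convert! key using 1
  set c := transitionScale f s r
  have hrad : transitionMean f (radialDeriv φ) s x r
      = c * (∫ z, fderiv ℝ φ (c • x + transitionNoise f s r • z) x ∂(stdGaussian V))
        + transitionNoise f s r * (transitionNoise f s r *
          transitionMean f (Laplacian.laplacian φ) s x r) := by
    obtain ⟨i1, i2⟩ := integrable_fderiv_apply hφ1 hD (c • x) x (transitionNoise f s r)
    have e := integral_fderiv_apply_self hφ hc (c • x) (transitionNoise f s r)
    simp only [transitionMean, gaussianMean, radialDeriv, map_add, map_smul, smul_eq_mul]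
    rw [integral_add (i1.const_mul _) (i2.const_mul _), integral_const_mul, integral_const_mul, e]
  -- The normalisation by the clock gives exactly the coefficient of `½ Δ`.
  have hsq : Real.exp (driftPrimitive f r) / (2 * √(driftClock f r - driftClock f s))
      * transitionNoise f s r = 1 / 2 := by
    have h1 := Real.sqrt_pos.2 hpos
    rw [transitionNoise, Real.exp_neg]
    field_simp
  rw [hrad]
  change _ = _ + _ * (_ * transitionMean f (Laplacian.laplacian φ) s x r)
  linear_combination (-transitionMean f (Laplacian.laplacian φ) s x r) * hsq

theorem intervalIntegrable_generator (hf : IsDriftCoefficient f) (hφ : ContDiff ℝ 2 φ)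
    (hc : HasCompactSupport φ) {a b : ℝ} (ha : a ∈ Ico (0 : ℝ) 1) (hb : b ∈ Ico (0 : ℝ) 1)
    (x : V) :
    IntervalIntegrable (fun r => 1 / 2 * transitionMean f (Laplacian.laplacian φ) s x r
      - f r * transitionMean f (radialDeriv φ) s x r) volume a b :=
  (((continuousOn_transitionMean hf (continuous_laplacian hφ) (hasCompactSupport_laplacian hc)
    s x).mono (uIcc_subset_Ico_zero_one ha hb)).intervalIntegrable.const_mul _).sub
  (hf.intervalIntegrable_smul ha hb (continuousOn_transitionMean hf
    (continuous_radialDeriv (hφ.of_le (by norm_num))) (hasCompactSupport_radialDeriv hc) s x))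

/-- The derivative formula is singular at `r = s`, so the identity is proved on `[a, t]` with `a >
s`. -/
theorem integral_generator (hf : IsDriftCoefficient f) (hφ : ContDiff ℝ 2 φ)
    (hc : HasCompactSupport φ) (hs : s ∈ Ico (0 : ℝ) 1) (ht : t ∈ Ico (0 : ℝ) 1) (hst : s ≤ t)
    (x : V) :
    transitionMean f φ s x t = φ x
      + ∫ r in s..t, (1 / 2 * transitionMean f (Laplacian.laplacian φ) s x r
        - f r * transitionMean f (radialDeriv φ) s x r) := by
  rcases hst.eq_or_lt with rfl | hst
  · simp [transitionMean_self]
  set g : ℝ → ℝ := fun r => 1 / 2 * transitionMean f (Laplacian.laplacian φ) s x r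
        - f r * transitionMean f (radialDeriv φ) s x r with hg
  have hint : ∀ a ∈ Ico (0 : ℝ) 1, ∀ b ∈ Ico (0 : ℝ) 1, IntervalIntegrable g volume a b :=
    fun a ha b hb => intervalIntegrable_generator hf hφ hc ha hb x
  have hφ1 : ContDiff ℝ 1 φ := hφ.of_le (by norm_num)
  obtain ⟨K, hK⟩ := hφ1.lipschitzWith_of_hasCompactSupport hc one_ne_zero
  obtain ⟨C, -, hC⟩ := exists_bound_of_compactSupport hφ1.continuous hc
  have hinner : ∀ a ∈ Ioc s t, ∫ r in a..t, g r
      = transitionMean f φ s x t - transitionMean f φ s x a := fun a ha => by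
    have ha' : a ∈ Ico (0 : ℝ) 1 := ⟨hs.1.trans ha.1.le, ha.2.trans_lt ht.2⟩
    refine (AbsolutelyContinuousOnInterval.of_dist_le _ _
      (absolutelyContinuousOnInterval_transitionScale (s := s) hf ha' ht)
      (absolutelyContinuousOnInterval_transitionNoise hf hs ha.1 ha.2 ht.2)
      fun u _ v _ => dist_gaussianMean_le hK hC x _ _).integral_eq_sub_of_ae_hasDerivAt ?_
      (hint a ha' t ht)
    filter_upwards [hf.ae_hasDerivAt ha' ht] with r h hr
    rw [uIcc_of_le ha.2] at hr h
    exact hasDerivAt_transitionMean hf hφ hc hs (ha.1.trans_le hr.1) (hr.2.trans_lt ht.2) (h hr) x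
  have hsub : Icc s t ⊆ Ico 0 1 := fun r hr => ⟨hs.1.trans hr.1, hr.2.trans_lt ht.2⟩
  have hcM := (continuousOn_transitionMean hf hφ.continuous hc s x).mono hsub
  have hcI : ContinuousOn (fun a => ∫ r in a..t, g r) (Icc s t) := by
    have h := ((hint s hs t ht).absolutelyContinuousOnInterval_primitive
      (c := t) right_mem_uIcc).continuousOn.neg
    rw [uIcc_of_le hst.le] at h
    exact h.congr fun a _ => intervalIntegral.integral_symm _ _
  -- Both sides are continuous in `a` on `[s, t]` and agree on the dense subset `(s, t]`, so `a = s`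
  -- is allowed.
  have hlim : EqOn (fun a => ∫ r in a..t, g r)
      (fun a => transitionMean f φ s x t - transitionMean f φ s x a) (Icc s t) := by
    refine EqOn.of_subset_closure (s := Ioc s t) hinner hcI (continuousOn_const.sub hcM)
      Ioc_subset_Icc_self ?_
    rw [closure_Ioc hst.ne]
  have := hlim ⟨le_rfl, hst.le⟩
  simp only [transitionMean_self] at this
  linarith

end Generator

/-! ### Uniform convergence at time zero -/

section Uniform

variable {f : ℝ → ℝ} {s t : ℝ}

theorem tendsto_transitionScale (hf : IsDriftCoefficient f) (hs : s ∈ Ico (0 : ℝ) 1) :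
    Tendsto (transitionScale f s) (𝓝[>] s) (𝓝 1) := by
  have h := continuousOn_transitionScale hf s s hs
  rw [ContinuousWithinAt, transitionScale_self] at h
  refine h.mono_left (nhdsWithin_le_of_mem ?_)
  filter_upwards [Ioo_mem_nhdsGT hs.2] with r hr using ⟨hs.1.trans hr.1.le, hr.2⟩

theorem tendsto_transitionNoise (hf : IsDriftCoefficient f) (hs : s ∈ Ico (0 : ℝ) 1) :
    Tendsto (transitionNoise f s) (𝓝[>] s) (𝓝 0) := by
  have h := continuousOn_transitionNoise hf s s hs
  rw [ContinuousWithinAt, transitionNoise_self] at h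
  refine h.mono_left (nhdsWithin_le_of_mem ?_)
  filter_upwards [Ioo_mem_nhdsGT hs.2] with r hr using ⟨hs.1.trans hr.1.le, hr.2⟩

/-- The displacement `c • x - x` is unbounded in `x`, but for `‖x‖ > 2 R` and `c ≥ 1/2` both `x` and
`c • x` lie where `g` vanishes. This gives uniformity in `x`. -/
theorem LipschitzWith.dist_smul_le_of_compactSupport {W : Type*} [NormedAddCommGroup W]
    [NormedSpace ℝ W] {g : W → ℝ} {K : ℝ≥0} (hg : LipschitzWith K g) {R : ℝ} (hR : 0 ≤ R)
    (hsupp : ∀ x, R < ‖x‖ → g x = 0) {c : ℝ} (hc : 1 / 2 ≤ c) (x : W) :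
    dist (g (c • x)) (g x) ≤ K * (2 * R) * |c - 1| := by
  rcases le_or_gt ‖x‖ (2 * R) with hx | hx
  · refine (hg.dist_le_mul _ _).trans ?_
    have : dist (c • x) x = |c - 1| * ‖x‖ := by
      rw [dist_eq_norm, ← Real.norm_eq_abs, ← norm_smul, sub_smul, one_smul]
    rw [this, mul_assoc, mul_comm (2 * R)]
    gcongr
  · have h1 : R < ‖c • x‖ := by
      rw [norm_smul, Real.norm_of_nonneg (by linarith)]
      nlinarith
    rw [hsupp _ h1, hsupp x (by linarith), dist_self]
    positivity

variable {V : Type*} [NormedAddCommGroup V] [InnerProductSpace ℝ V] {φ : V → ℝ}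

theorem contDiff_radialDeriv (hφ : ContDiff ℝ 3 φ) : ContDiff ℝ 1 (radialDeriv φ) :=
  ((hφ.fderiv_right (m := 2) (by norm_num)).of_le (by norm_num)).clm_apply contDiff_id

variable [FiniteDimensional ℝ V]

theorem contDiff_laplacian (hφ : ContDiff ℝ 3 φ) : ContDiff ℝ 1 (Laplacian.laplacian φ) := by
  have e : Laplacian.laplacian φ = fun y => ∑ i, fderiv ℝ (fderiv ℝ φ) y
      (stdOrthonormalBasis ℝ V i) (stdOrthonormalBasis ℝ V i) := funext (laplacian_eq_sum φ)
  have h : ContDiff ℝ 1 (fderiv ℝ (fderiv ℝ φ)) :=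
    (hφ.fderiv_right (m := 2) (by norm_num)).fderiv_right (by norm_num)
  rw [e]
  fun_prop

variable [MeasurableSpace V] [BorelSpace V]

theorem eventually_forall_transitionMean_sub_le (hf : IsDriftCoefficient f)
    (hs : s ∈ Ico (0 : ℝ) 1) {g : V → ℝ} (hg : ContDiff ℝ 1 g) (hc : HasCompactSupport g) {ε : ℝ}
    (hε : 0 < ε) : ∀ᶠ r in 𝓝[>] s, ∀ x, |transitionMean f g s x r - g x| ≤ ε := by
  obtain ⟨K, hK⟩ := hg.lipschitzWith_of_hasCompactSupport hc one_ne_zero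
  obtain ⟨C, -, hC⟩ := exists_bound_of_compactSupport hg.continuous hc
  obtain ⟨R, hR⟩ := hc.isCompact.isBounded.subset_closedBall 0
  have hsupp : ∀ x, |R| < ‖x‖ → g x = 0 := fun x hx => by
    by_contra h
    have := hR (subset_tsupport _ h)
    rw [mem_closedBall_zero_iff] at this
    exact absurd (this.trans (le_abs_self R)) (not_le.2 hx)
  have hlim : Tendsto (fun r => K * (∫ z, ‖z‖ ∂(stdGaussian V)) * |transitionNoise f s r|
      + K * (2 * |R|) * |transitionScale f s r - 1|) (𝓝[>] s) (𝓝 0) := by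
    have := ((tendsto_transitionNoise hf hs).abs.const_mul (K * (∫ z, ‖z‖ ∂(stdGaussian V)))).add
      (((tendsto_transitionScale hf hs).sub_const 1).abs.const_mul (K * (2 * |R|)))
    simpa using this
  filter_upwards [hlim.eventually_le_const hε,
    (tendsto_transitionScale hf hs).eventually_const_le (by norm_num : (1 / 2 : ℝ) < 1)]
    with r hr hc x
  -- Remove the noise at fixed scale first, where the bound does not involve `x`; then compare `g (c
  -- • x)` with `g x`.
  have h1 := dist_gaussianMean_le hK hC x (transitionScale f s r, transitionNoise f s r)
    (transitionScale f s r, 0)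
  have h2 := hK.dist_smul_le_of_compactSupport (abs_nonneg R) hsupp hc x
  have h3 : gaussianMean g x (transitionScale f s r, 0) = g (transitionScale f s r • x) := by
    simp [gaussianMean]
  simp only [h3, dist_self, mul_zero, zero_add, dist_zero_right, Real.norm_eq_abs] at h1
  rw [← Real.dist_eq]
  exact (dist_triangle _ _ _).trans ((add_le_add h1 h2).trans hr)

/-- By `integral_generator` the quotient is an average of the generator over `[s, s + h]`. Three
derivatives of `φ` make its Laplacian and radial derivative `C¹`, hence Lipschitz, so their means
converge uniformly; right continuity controls `f`. -/
theorem tendstoUniformly_generator (hf : IsDriftCoefficient f) (hφ : ContDiff ℝ 3 φ)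
    (hc : HasCompactSupport φ) (hs : s ∈ Ico (0 : ℝ) 1) (hfs : ContinuousWithinAt f (Ici s) s) :
    TendstoUniformly (fun h x => (transitionMean f φ s x (s + h) - φ x) / h)
      (fun x => 1 / 2 * Laplacian.laplacian φ x - f s * radialDeriv φ x) (𝓝[>] 0) := by
  have hφ2 : ContDiff ℝ 2 φ := hφ.of_le (by norm_num)
  have hrc := hasCompactSupport_radialDeriv hc
  obtain ⟨C, hC0, hC⟩ := exists_bound_of_compactSupport (contDiff_radialDeriv hφ).continuous hrc
  rw [Metric.tendstoUniformly_iff]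
  intro ε hε
  -- The integrand's error will be at most `½ η + (|f s| + 1) η + C η`, below `(|f s| + C + 3) η = ε
  -- / 2`. The minimum with `1` in the next step gives `|f r| ≤ |f s| + 1`.
  set η := ε / (2 * (|f s| + C + 3)) with hη
  have hη0 : 0 < η := by positivity
  have hev : ∀ᶠ r in 𝓝[>] s, ((∀ x, |transitionMean f (Laplacian.laplacian φ) s x r
      - Laplacian.laplacian φ x| ≤ η) ∧
      (∀ x, |transitionMean f (radialDeriv φ) s x r - radialDeriv φ x| ≤ η)) ∧
      |f r - f s| ≤ min η 1 ∧ r < 1 := by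
    refine ((eventually_forall_transitionMean_sub_le hf hs (contDiff_laplacian hφ)
      (hasCompactSupport_laplacian hc) hη0).and
      (eventually_forall_transitionMean_sub_le hf hs (contDiff_radialDeriv hφ) hrc hη0)).and
      (Eventually.and ?_ ?_)
    · filter_upwards [Metric.tendsto_nhds.1 (hfs.mono_left (nhdsWithin_mono _ Ioi_subset_Ici_self))
        (min η 1) (by positivity)] with r hr using hr.le
    · filter_upwards [Ioo_mem_nhdsGT hs.2] with r hr using hr.2
  obtain ⟨u, hu, hIoo⟩ := mem_nhdsGT_iff_exists_Ioo_subset.1 hev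
  filter_upwards [Ioo_mem_nhdsGT (sub_pos.2 (mem_Ioi.1 hu))] with h hh x
  have hr : ∀ r ∈ Ioc s (s + h), _ := fun r hr => hIoo ⟨hr.1, by linarith [hr.2, hh.2]⟩
  have hsh : s ≤ s + h := by linarith [hh.1]
  have hsh1 : s + h ∈ Ico (0 : ℝ) 1 :=
    ⟨hs.1.trans hsh, (hr (s + h) ⟨by linarith [hh.1], le_rfl⟩).2.2⟩
  have key := integral_generator hf hφ2 hc hs hsh1 hsh x
  set L := 1 / 2 * Laplacian.laplacian φ x - f s * radialDeriv φ x with hL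
  have hconst : ∫ _ in s..s + h, L = h * L := by simp
  have hdiff : transitionMean f φ s x (s + h) - φ x - h * L
      = ∫ r in s..s + h, ((1 / 2 * transitionMean f (Laplacian.laplacian φ) s x r
        - f r * transitionMean f (radialDeriv φ) s x r) - L) := by
    rw [intervalIntegral.integral_sub (intervalIntegrable_generator hf hφ2 hc hs hsh1 x) (by simp),
      hconst, key]
    ring
  have hbound : ‖transitionMean f φ s x (s + h) - φ x - h * L‖ ≤ ε / 2 * |s + h - s| := by
    rw [hdiff]
    refine intervalIntegral.norm_integral_le_of_norm_le_const fun r hr' => ?_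
    rw [uIoc_of_le hsh] at hr'
    obtain ⟨⟨h1, h2⟩, h3, -⟩ := hr r hr'
    have h1 := h1 x
    have h2 := h2 x
    have h4 : |f r| ≤ |f s| + 1 := by
      have := abs_sub_abs_le_abs_sub (f r) (f s)
      linarith [min_le_right η 1]
    have h3 := h3.trans (min_le_left η 1)
    have hCx := hC x
    rw [Real.norm_eq_abs] at hCx ⊢
    have e : 1 / 2 * transitionMean f (Laplacian.laplacian φ) s x r
        - f r * transitionMean f (radialDeriv φ) s x r - L
        = 1 / 2 * (transitionMean f (Laplacian.laplacian φ) s x r - Laplacian.laplacian φ x)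
          - (f r * (transitionMean f (radialDeriv φ) s x r - radialDeriv φ x)
            + (f r - f s) * radialDeriv φ x) := by rw [hL]; ring
    rw [e]
    calc _ ≤ |1 / 2 * (transitionMean f (Laplacian.laplacian φ) s x r - Laplacian.laplacian φ x)|
          + (|f r * (transitionMean f (radialDeriv φ) s x r - radialDeriv φ x)|
            + |(f r - f s) * radialDeriv φ x|) :=
          (abs_sub _ _).trans (by gcongr; exact abs_add_le _ _)
      _ ≤ 1 / 2 * η + ((|f s| + 1) * η + η * C) := by
          rw [abs_mul, abs_mul, abs_mul, abs_of_pos (by norm_num : (0 : ℝ) < 1 / 2)]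
          gcongr
      _ ≤ (|f s| + C + 3) * η := by nlinarith
      _ = ε / 2 := by rw [hη]; field_simp
  rw [dist_comm, dist_eq_norm]
  have hh0 : h ≠ 0 := hh.1.ne'
  have e : (transitionMean f φ s x (s + h) - φ x) / h - L
      = (transitionMean f φ s x (s + h) - φ x - h * L) / h := by field_simp
  rw [e, norm_div, Real.norm_of_nonneg hh.1.le, div_lt_iff₀ hh.1]
  refine hbound.trans_lt ?_
  rw [add_sub_cancel_left, abs_of_pos hh.1]
  nlinarith [hh.1]

end Uniform

/-! ### The transition kernels -/

section Kernel

variable {f : ℝ → ℝ} {s t u : ℝ} {V : Type*} [NormedAddCommGroup V] [InnerProductSpace ℝ V]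
  [FiniteDimensional ℝ V] [MeasurableSpace V] [BorelSpace V]

variable (V) in
/-- The Gaussian transition kernel from time `s` to time `t`. -/
noncomputable def bridgeKernel (f : ℝ → ℝ) (s t : ℝ) : Kernel V V :=
  (Kernel.id ×ₖ Kernel.const V (stdGaussian V)).map
    fun p => transitionScale f s t • p.1 + transitionNoise f s t • p.2

instance : IsMarkovKernel (bridgeKernel V f s t) :=
  Kernel.IsMarkovKernel.map _ (by fun_prop)

theorem bridgeKernel_apply (x : V) :
    bridgeKernel V f s t x = (stdGaussian V).map
      fun z => transitionScale f s t • x + transitionNoise f s t • z := by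
  rw [bridgeKernel, Kernel.map_apply _ (by fun_prop), Kernel.prod_apply, Kernel.id_apply,
    Kernel.const_apply, Measure.dirac_prod, Measure.map_map (by fun_prop) (by fun_prop)]
  rfl

theorem integral_bridgeKernel {g : V → ℝ} (hg : Continuous g) (x : V) :
    ∫ w, g w ∂(bridgeKernel V f s t x) = transitionMean f g s x t := by
  rw [bridgeKernel_apply, integral_map (by fun_prop) hg.aestronglyMeasurable]
  rfl

theorem bridgeKernel_self (s : ℝ) : bridgeKernel V f s s = Kernel.id := by
  ext1 x
  rw [bridgeKernel_apply, Kernel.id_apply]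
  simp [transitionScale_self, transitionNoise_self]

theorem charFun_bridgeKernel (x ξ : V) :
    charFun (bridgeKernel V f s t x) ξ =
      Complex.exp (inner ℝ x (transitionScale f s t • ξ) * Complex.I) *
        Complex.exp (-(transitionNoise f s t ^ 2 * ‖ξ‖ ^ 2 / 2 : ℝ)) := by
  have h : charFun (stdGaussian V) (transitionNoise f s t • ξ)
      = Complex.exp (-(transitionNoise f s t ^ 2 * ‖ξ‖ ^ 2 / 2 : ℝ)) := by
    rw [charFun_stdGaussian, norm_smul, Real.norm_eq_abs, neg_div]
    congr 2
    rw [← Complex.ofReal_pow, mul_pow, sq_abs]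
    push_cast
    ring
  rw [← h, charFun_apply, charFun_apply, bridgeKernel_apply, integral_map (by fun_prop)
    (Continuous.aestronglyMeasurable (by fun_prop)), ← integral_const_mul]
  refine integral_congr_ae (ae_of_all _ fun z => ?_)
  simp only
  rw [← Complex.exp_add, inner_add_left, real_inner_smul_left, real_inner_smul_left,
    real_inner_smul_right, real_inner_smul_right]
  push_cast
  ring_nf

theorem transitionScale_mul (f : ℝ → ℝ) (s t u : ℝ) :
    transitionScale f s t * transitionScale f t u = transitionScale f s u := by
  rw [transitionScale, transitionScale, transitionScale, ← Real.exp_add]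
  congr 1
  ring

theorem transitionNoise_sq (hf : IsDriftCoefficient f) (hs : s ∈ Ico (0 : ℝ) 1)
    (ht : t ∈ Ico (0 : ℝ) 1) (hst : s ≤ t) :
    transitionNoise f s t ^ 2 =
      Real.exp (-driftPrimitive f t) ^ 2 * (driftClock f t - driftClock f s) := by
  rw [transitionNoise, mul_pow, Real.sq_sqrt (sub_nonneg.2 (hf.clock_mono hs ht hst))]

/-- On characteristic functions, scales multiply and variances satisfy `c(t,u)² σ(s,t)² + σ(t,u)² =
σ(s,u)²`, because clock increments add. -/
theorem bridgeKernel_comp (hf : IsDriftCoefficient f) (hs : s ∈ Ico (0 : ℝ) 1) (hst : s ≤ t)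
    (htu : t ≤ u) (hu : u ∈ Ico (0 : ℝ) 1) :
    bridgeKernel V f t u ∘ₖ bridgeKernel V f s t = bridgeKernel V f s u := by
  have ht : t ∈ Ico (0 : ℝ) 1 := ⟨hs.1.trans hst, htu.trans_lt hu.2⟩
  ext1 x
  refine Measure.ext_of_charFun ?_
  ext ξ
  have hint : Integrable (fun w : V => Complex.exp (inner ℝ w ξ * Complex.I))
      ((bridgeKernel V f t u ∘ₖ bridgeKernel V f s t) x) :=
    Integrable.of_bound (Continuous.aestronglyMeasurable (by fun_prop)) 1
      (ae_of_all _ fun w => (Complex.norm_exp_ofReal_mul_I _).le)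
  rw [charFun_apply, Kernel.integral_comp hint]
  simp_rw [← charFun_apply, charFun_bridgeKernel (s := t)]
  rw [integral_mul_const, ← charFun_apply, charFun_bridgeKernel, charFun_bridgeKernel, smul_smul,
    transitionScale_mul, mul_assoc, ← Complex.exp_add, ← Complex.ofReal_neg, ← Complex.ofReal_neg,
    ← Complex.ofReal_neg, ← Complex.ofReal_add, norm_smul, mul_pow, Real.norm_eq_abs, sq_abs,
    transitionNoise_sq hf hs ht hst, transitionNoise_sq hf ht hu htu,
    transitionNoise_sq hf hs hu (hst.trans htu)]
  congr 4
  have e : transitionScale f t u ^ 2 * Real.exp (-driftPrimitive f t) ^ 2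
      = Real.exp (-driftPrimitive f u) ^ 2 := by
    rw [transitionScale, ← mul_pow, ← Real.exp_add]
    congr 2
    ring
  linear_combination (-(driftClock f t - driftClock f s) * ‖ξ‖ ^ 2 / 2) * e

theorem isTransitionFamily_bridgeKernel (hf : IsDriftCoefficient f) :
    IsTransitionFamily (bridgeKernel V f) where
  isMarkovKernel _ _ _ _ _ := inferInstance
  refl s _ _ := bridgeKernel_self s
  comp _ _ _ hs hst htu hu := bridgeKernel_comp hf ⟨hs, hst.trans_lt (htu.trans_lt hu)⟩ hst htu
    ⟨hs.trans (hst.trans htu), hu⟩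

end Kernel

/-! ### The generator of the transition kernels on `ℝⁿ` -/

section BridgeGenerator

variable {f : ℝ → ℝ} {n : ℕ} {φ : EuclideanSpace ℝ (Fin n) → ℝ}

/-- The gradient of `‖w‖² / 2` is the position vector, so the drift acts as the radial derivative.
-/
theorem bridgeOperator_zero (f : ℝ → ℝ) (r : ℝ) (φ : EuclideanSpace ℝ (Fin n) → ℝ)
    (x : EuclideanSpace ℝ (Fin n)) :
    bridgeOperator f 0 r φ x = 1 / 2 * Laplacian.laplacian φ x - f r * radialDeriv φ x := by
  have hg : gradient (fun w : EuclideanSpace ℝ (Fin n) => dist w 0 ^ 2 / 2) x = x := by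
    refine HasGradientAt.gradient ?_
    rw [hasGradientAt_iff_hasFDerivAt]
    simp only [dist_zero_right, div_eq_mul_inv]
    refine ((hasStrictFDerivAt_norm_sq x).hasFDerivAt.mul_const (2⁻¹ : ℝ)).congr_fderiv ?_
    ext v
    simp
  rw [bridgeOperator, hg, radialDeriv, gradient, real_inner_comm, InnerProductSpace.toDual_symm_apply]

theorem integral_bridgeOperator (hφ : ContDiff ℝ 2 φ) (hc : HasCompactSupport φ) (s r : ℝ)
    (x : EuclideanSpace ℝ (Fin n)) :
    ∫ w, bridgeOperator f 0 r φ w ∂(bridgeKernel _ f s r x)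
      = 1 / 2 * transitionMean f (Laplacian.laplacian φ) s x r
        - f r * transitionMean f (radialDeriv φ) s x r := by
  have c1 := continuous_laplacian hφ
  have c2 := continuous_radialDeriv (hφ.of_le (by norm_num : (1 : WithTop ℕ∞) ≤ 2))
  obtain ⟨C, -, hC⟩ := exists_bound_of_compactSupport c1 (hasCompactSupport_laplacian hc)
  obtain ⟨D, -, hD⟩ := exists_bound_of_compactSupport c2 (hasCompactSupport_radialDeriv hc)
  simp_rw [bridgeOperator_zero]
  rw [integral_sub ((Integrable.of_bound c1.aestronglyMeasurable C (ae_of_all _ hC)).const_mul _)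
    ((Integrable.of_bound c2.aestronglyMeasurable D (ae_of_all _ hD)).const_mul _),
    integral_const_mul, integral_const_mul, integral_bridgeKernel c1, integral_bridgeKernel c2]

theorem hasBridgeGenerator_bridgeKernel (hf : IsDriftCoefficient f) :
    HasBridgeGenerator f 0 (bridgeKernel (EuclideanSpace ℝ (Fin n)) f) where
  intervalIntegrable φ hφ hc s t hs hst ht x := by
    have hφ2 : ContDiff ℝ 2 φ := by exact_mod_cast contDiff_infty.1 hφ 2
    simp_rw [integral_bridgeOperator hφ2 hc]
    exact intervalIntegrable_generator hf hφ2 hc ⟨hs, hst.trans_lt ht⟩ ⟨hs.trans hst, ht⟩ x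
  integral_eq φ hφ hc s t hs hst ht x := by
    have hφ2 : ContDiff ℝ 2 φ := by exact_mod_cast contDiff_infty.1 hφ 2
    simp_rw [integral_bridgeOperator hφ2 hc, integral_bridgeKernel hφ.continuous]
    exact integral_generator hf hφ2 hc ⟨hs, hst.trans_lt ht⟩ ⟨hs.trans hst, ht⟩ hst x
  tendstoUniformly φ hφ hc s hs hfs := by
    have hφ3 : ContDiff ℝ 3 φ := by exact_mod_cast contDiff_infty.1 hφ 3
    have h := tendstoUniformly_generator hf hφ3 hc hs hfs
    simp_rw [integral_bridgeKernel hφ.continuous]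
    convert! h using 1
    exact funext fun x => bridgeOperator_zero f s φ x

end BridgeGenerator

/-! ### Independence -/

section Independence

variable {Ω : Type*}

/-- The joint law is a product over `i` of products of two laws; exchanging the order of the factors
separates the `S i` from the `T i`. -/
theorem ProbabilityTheory.iIndepFun.indepFun_pi [MeasurableSpace Ω] {μ : Measure Ω}
    [IsProbabilityMeasure μ] {ι α β : Type*} [Fintype ι] [MeasurableSpace α]
    [MeasurableSpace β] {S : ι → Ω → α} {T : ι → Ω → β} (hS : ∀ i, Measurable (S i))
    (hT : ∀ i, Measurable (T i)) (h : iIndepFun (fun i ω => (S i ω, T i ω)) μ)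
    (hST : ∀ i, IndepFun (S i) (T i) μ) :
    IndepFun (fun ω i => S i ω) (fun ω i => T i ω) μ := by
  have hS' : iIndepFun S μ := h.comp (fun _ => Prod.fst) fun _ => measurable_fst
  have hT' : iIndepFun T μ := h.comp (fun _ => Prod.snd) fun _ => measurable_snd
  have e1 := (iIndepFun_iff_map_fun_eq_pi_map fun i => (hS i).aemeasurable).1 hS'
  have e2 := (iIndepFun_iff_map_fun_eq_pi_map fun i => (hT i).aemeasurable).1 hT'
  have e3 := (iIndepFun_iff_map_fun_eq_pi_map
    fun i => ((hS i).prodMk (hT i)).aemeasurable).1 h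
  have e4 : ∀ i, μ.map (fun ω => (S i ω, T i ω)) = (μ.map (S i)).prod (μ.map (T i)) := fun i =>
    (indepFun_iff_map_prod_eq_prod_map_map (hS i).aemeasurable (hT i).aemeasurable).1 (hST i)
  have p1 : ∀ i, IsProbabilityMeasure (μ.map (S i)) := fun i =>
    Measure.isProbabilityMeasure_map (hS i).aemeasurable
  have p2 : ∀ i, IsProbabilityMeasure (μ.map (T i)) := fun i =>
    Measure.isProbabilityMeasure_map (hT i).aemeasurable
  rw [indepFun_iff_map_prod_eq_prod_map_map (measurable_pi_lambda _ hS).aemeasurable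
    (measurable_pi_lambda _ hT).aemeasurable, e1, e2,
    ← (measurePreserving_arrowProdEquivProdArrow α β ι (fun i => μ.map (S i))
      (fun i => μ.map (T i))).map_eq]
  simp_rw [e4] at e3
  rw [← e3, Measure.map_map (MeasurableEquiv.measurable _)
    (measurable_pi_lambda _ fun i => (hS i).prodMk (hT i))]
  rfl

/-- The conditional law of `g (X, Y)` when `X` is known and `Y` is independent of the past. -/
theorem condExp_indicator_of_indep {m m0 : MeasurableSpace Ω} {μ : Measure[m0] Ω}
    [IsProbabilityMeasure μ] (hm : m ≤ m0)
    {α β γ : Type*} [MeasurableSpace α] [MeasurableSpace β] [MeasurableSpace γ]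
    {X : Ω → α} {Y : Ω → β} {Z : Ω → γ} {g : α × β → γ} (hX : Measurable[m] X) (hY : Measurable Y)
    (hZ : Measurable Z) (hg : Measurable g) (hZg : ∀ᵐ ω ∂μ, Z ω = g (X ω, Y ω))
    (hind : Indep m (MeasurableSpace.comap Y inferInstance) μ) {κ : Kernel α γ} [IsMarkovKernel κ]
    (hκ : ∀ x, κ x = (μ.map Y).map fun y => g (x, y)) {A : Set γ} (hA : MeasurableSet A) :
    μ[(Z ⁻¹' A).indicator (fun _ => (1 : ℝ)) | m] =ᵐ[μ] fun ω => (κ (X ω)).real A := by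
  have hXm : Measurable X := hX.mono hm le_rfl
  have hκm : Measurable[m] fun ω => (κ (X ω)).real A :=
    ((κ.measurable_coe hA).ennreal_toReal).comp hX
  have hκint : Integrable (fun ω => (κ (X ω)).real A) μ :=
    Integrable.of_bound (hκm.mono hm le_rfl).aestronglyMeasurable 1 (ae_of_all _ fun ω => by
      rw [Real.norm_of_nonneg measureReal_nonneg]
      exact measureReal_le_one)
  refine (ae_eq_condExp_of_forall_setIntegral_eq hm
    ((integrable_const 1).indicator (hZ hA)) (fun _ _ _ => hκint.integrableOn) (fun C hC _ => ?_)
    hκm.aestronglyMeasurable).symm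
  have hC0 : MeasurableSet C := hm C hC
  -- Carrying the indicator of the past event `C` alongside `X` reduces the claim to Fubini for the
  -- product law of `W` and `Y`.
  set W : Ω → ℝ × α := fun ω => (C.indicator (fun _ => (1 : ℝ)) ω, X ω)
  have hW : Measurable[m] W := (measurable_const.indicator hC).prodMk hX
  have hWm : Measurable W := hW.mono hm le_rfl
  have hWY : IndepFun W Y μ := indep_of_indep_of_le_left hind hW.comap_le
  have hlaw := (indepFun_iff_map_prod_eq_prod_map_map hWm.aemeasurable hY.aemeasurable).1 hWY
  set D : Set ((ℝ × α) × β) := {p | p.1.1 = 1 ∧ g (p.1.2, p.2) ∈ A} with hD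
  have hDm : MeasurableSet D :=
    (measurableSet_eq_fun (by fun_prop) measurable_const).inter
      ((hg.comp (by fun_prop : Measurable fun p : (ℝ × α) × β => (p.1.2, p.2))) hA)
  have pY : IsProbabilityMeasure (μ.map Y) := Measure.isProbabilityMeasure_map hY.aemeasurable
  have h1 : μ (C ∩ Z ⁻¹' A) = ∫⁻ ω in C, κ (X ω) A ∂μ := by
    have h2 : μ (C ∩ Z ⁻¹' A) = μ.map (fun ω => (W ω, Y ω)) D := by
      rw [Measure.map_apply (hWm.prodMk hY) hDm]
      refine measure_congr ?_
      filter_upwards [hZg] with ω hω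
      refine propext ?_
      change (ω ∈ C ∧ Z ω ∈ A) ↔ (C.indicator (fun _ => (1 : ℝ)) ω = 1 ∧ g (X ω, Y ω) ∈ A)
      rw [hω]
      by_cases h : ω ∈ C <;> simp [h]
    rw [h2, hlaw, Measure.prod_apply hDm, lintegral_map (measurable_measure_prodMk_left hDm) hWm,
      ← lintegral_indicator hC0]
    refine lintegral_congr fun ω => ?_
    by_cases h : ω ∈ C
    · rw [indicator_of_mem h, hκ, Measure.map_apply (by fun_prop) hA]
      congr 1
      ext y
      simp [hD, W, h]
    · rw [indicator_of_notMem h]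
      have : Prod.mk (W ω) ⁻¹' D = ∅ := by
        ext y
        simp [hD, W, h]
      rw [this, measure_empty]
  rw [integral_indicator (hZ hA), setIntegral_const, smul_eq_mul, mul_one,
    measureReal_restrict_apply (hZ hA), inter_comm, Measure.real, h1]
  exact integral_toReal ((κ.measurable_coe hA).comp hXm).aemeasurable
    (ae_of_all _ fun ω => measure_lt_top _ _)

/-- One path-valued map generates the history, so independence from the past can be stated for
random variables. -/
theorem history_eq_comap {E : Type*} [MeasurableSpace E] (z : ℝ → Ω → E) (s : ℝ) :
    history z s = MeasurableSpace.comap (fun ω (r : Icc (0 : ℝ) s) => z r ω) inferInstance := by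
  rw [history, MeasurableSpace.pi, MeasurableSpace.comap_iSup, iSup_subtype']
  simp_rw [MeasurableSpace.comap_comp]
  rfl

theorem history_le [MeasurableSpace Ω] {E : Type*} [MeasurableSpace E] {z : ℝ → Ω → E} {s : ℝ}
    (hz : ∀ r ∈ Icc (0 : ℝ) s, Measurable (z r)) : history z s ≤ ‹MeasurableSpace Ω› :=
  iSup₂_le fun r hr => (hz r hr).comap_le

theorem measurable_history {E : Type*} [MeasurableSpace E] (z : ℝ → Ω → E) {s : ℝ} (hs : 0 ≤ s) :
    Measurable[history z s] (z s) :=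
  measurable_iff_comap_le.2 (le_iSup₂_of_le s ⟨hs, le_rfl⟩ le_rfl)

theorem history_congr {E : Type*} [MeasurableSpace E] {z z' : ℝ → Ω → E} {s : ℝ}
    (h : ∀ r ∈ Icc (0 : ℝ) s, z r = z' r) : history z s = history z' s :=
  iSup_congr fun r => iSup_congr fun hr => by rw [h r hr]

end Independence

/-! ### The integral `∫ exp F dB` -/

section BrownianIntegral

variable {Ω : Type*} {n : ℕ} {B : ℝ≥0 → Ω → EuclideanSpace ℝ (Fin n)} {f : ℝ → ℝ} {s t : ℝ}

/-- The path of `B`, indexed by real times. -/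
def brownianPath (B : ℝ≥0 → Ω → EuclideanSpace ℝ (Fin n)) (ω : Ω) (r : ℝ) :
    EuclideanSpace ℝ (Fin n) := B r.toNNReal ω

/-- The integral `∫_s^t exp (F r) dB r`, as a limit of Riemann sums. -/
noncomputable def brownianIntegral (f : ℝ → ℝ) (B : ℝ≥0 → Ω → EuclideanSpace ℝ (Fin n))
    (s t : ℝ) (ω : Ω) : EuclideanSpace ℝ (Fin n) :=
  limUnder atTop (riemannSum (fun r => Real.exp (driftPrimitive f r)) (brownianPath B ω) s t)

theorem brownianIntegral_eq (hf : IsDriftCoefficient f) (hs : s ∈ Ico (0 : ℝ) 1)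
    (ht : t ∈ Ico (0 : ℝ) 1) (hst : s ≤ t) {ω : Ω} (hω : Continuous (brownianPath B ω)) :
    brownianIntegral f B s t ω = pathIntegral f (brownianPath B ω) s t :=
  (tendsto_riemannSum_pathIntegral hf hs ht hst hω.continuousOn).limUnder_eq

/-- Only increments enter, so a constant shift of the path is harmless. -/
theorem riemannSum_congr {E : Type*} [NormedAddCommGroup E] [NormedSpace ℝ E] {w : ℝ → ℝ}
    {b b' : ℝ → E} {a : E} (hst : s ≤ t) (h : ∀ r ∈ Icc s t, b r = b' r - a) :
    riemannSum w b s t = riemannSum w b' s t := by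
  ext1 k
  refine Finset.sum_congr rfl fun i hi => ?_
  have hi := Finset.mem_range.1 hi
  rw [h _ (partition_mem_Icc hst hi.le), h _ (partition_mem_Icc hst hi), sub_sub_sub_cancel_right]

variable [MeasurableSpace Ω] {μ : Measure Ω}

theorem measurable_riemannSum {T : Type*} [MeasurableSpace T] {E : Type*} [NormedAddCommGroup E]
    [NormedSpace ℝ E] [MeasurableSpace E] [BorelSpace E] [SecondCountableTopology E]
    {b : T → ℝ → E} (hb : ∀ r, Measurable fun ω => b ω r) (w : ℝ → ℝ) (s t : ℝ) (k : ℕ) :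
    Measurable fun ω => riemannSum w (b ω) s t k :=
  Finset.measurable_sum _ fun _ _ => ((hb _).sub (hb _)).const_smul _

/-- Measurability holds on the whole space although convergence is known only along continuous
paths; no null set has to be removed. -/
theorem measurable_limUnder_riemannSum {T : Type*} [MeasurableSpace T] {E : Type*}
    [NormedAddCommGroup E] [NormedSpace ℝ E] [MeasurableSpace E] [BorelSpace E]
    [SecondCountableTopology E] [CompleteSpace E] {b : T → ℝ → E}
    (hb : ∀ r, Measurable fun ω => b ω r) (w : ℝ → ℝ) (s t : ℝ) :
    Measurable fun ω => limUnder atTop (riemannSum w (b ω) s t) :=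
  (StronglyMeasurable.limUnder fun k =>
    (measurable_riemannSum hb w s t k).stronglyMeasurable).measurable

theorem IsBrownianMotion.measurable_brownianIntegral (hB : IsBrownianMotion B μ) (f : ℝ → ℝ)
    (s t : ℝ) : Measurable (brownianIntegral f B s t) :=
  measurable_limUnder_riemannSum (fun _ => hB.measurable _) _ _ _

theorem IsBrownianMotion.ae_continuous (hB : IsBrownianMotion B μ) :
    ∀ᵐ ω ∂μ, Continuous (brownianPath B ω) := by
  filter_upwards [ae_all_iff.2 fun i => (hB.coord i).cont] with ω hω
  have h : Continuous fun t => B t ω :=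
    (PiLp.continuous_toLp 2 _).comp (continuous_pi hω)
  exact h.comp continuous_real_toNNReal

theorem IsBrownianMotion.ae_zero (hB : IsBrownianMotion B μ) :
    ∀ᵐ ω ∂μ, brownianPath B ω 0 = 0 := by
  filter_upwards [ae_all_iff.2 fun i => (hB.coord i).eval_zero_ae_eq_zero] with ω hω
  ext i
  simpa [brownianPath] using hω i

/-! #### Independence of the past and the future -/

/-- Each coordinate has this property; independence of the coordinates assembles them. -/
theorem IsBrownianMotion.indepFun_shift [IsProbabilityMeasure μ] (hB : IsBrownianMotion B μ)
    (u : ℝ≥0) :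
    IndepFun (fun ω (r : ℝ≥0) => B (u + r) ω - B u ω) (fun ω (r : Iic u) => B r ω) μ := by
  have hBi : ∀ i r, Measurable fun ω => B r ω i := fun i r => by
    have := hB.measurable r
    fun_prop
  have h1 : iIndepFun (fun (i : Fin n) ω =>
      ((fun r : ℝ≥0 => B (u + r) ω i - B u ω i), fun r : Iic u => B r ω i)) μ :=
    hB.indep.comp (fun _ w => ((fun r : ℝ≥0 => w (u + r) - w u), fun r : Iic u => w r))
      fun _ => by fun_prop
  have h2 := h1.indepFun_pi
    (fun i => measurable_pi_lambda _ fun r => (hBi i _).sub (hBi i _))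
    (fun i => measurable_pi_lambda _ fun r => hBi i _)
    fun i => (hB.coord i).indepFun_shift u
  exact h2.comp
    (φ := fun w (r : ℝ≥0) => (WithLp.toLp 2 fun i => w i r : EuclideanSpace ℝ (Fin n)))
    (ψ := fun w (r : Iic u) => (WithLp.toLp 2 fun i => w i r : EuclideanSpace ℝ (Fin n)))
    (by fun_prop) (by fun_prop)

theorem IsBrownianMotion.indepFun_brownianIntegral [IsProbabilityMeasure μ]
    (hB : IsBrownianMotion B μ) (f : ℝ → ℝ) (hs : 0 ≤ s) (hst : s ≤ t) :
    IndepFun (fun ω (r : Icc (0 : ℝ) s) =>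
        Real.exp (-driftPrimitive f r) • brownianIntegral f B 0 r ω)
      (brownianIntegral f B s t) μ := by
  set W : ℝ → ℝ := fun r => Real.exp (driftPrimitive f r)
  -- The integrals up to time `s` as a measurable functional of the path up to `s`. The minimum with
  -- `s` only makes the index legal: partition points of `[0, r]` never exceed `s`.
  set φ : (Iic s.toNNReal → EuclideanSpace ℝ (Fin n)) → Icc (0 : ℝ) s →
      EuclideanSpace ℝ (Fin n) := fun w r => Real.exp (-driftPrimitive f r) •
    limUnder atTop (riemannSum W
      (fun q => w ⟨min q.toNNReal s.toNNReal, mem_Iic.2 (min_le_right _ _)⟩) 0 r) with hφ_def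
  -- The integral over `[s, t]` as a functional of the path restarted at time `s`.
  set ψ : (ℝ≥0 → EuclideanSpace ℝ (Fin n)) → EuclideanSpace ℝ (Fin n) := fun w =>
    limUnder atTop (riemannSum W (fun q => w (q - s).toNNReal) s t) with hψ_def
  have hφ : Measurable φ := measurable_pi_lambda _ fun r => by
    have h := measurable_limUnder_riemannSum
      (b := fun (w : Iic s.toNNReal → EuclideanSpace ℝ (Fin n)) q =>
        w ⟨min q.toNNReal s.toNNReal, mem_Iic.2 (min_le_right _ _)⟩)
      (fun q => measurable_pi_apply _) W 0 r
    exact h.const_smul (Real.exp (-driftPrimitive f r))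
  have hψ : Measurable ψ := measurable_limUnder_riemannSum
    (b := fun (w : ℝ≥0 → EuclideanSpace ℝ (Fin n)) q => w (q - s).toNNReal)
    (fun q => measurable_pi_apply _) W s t
  have e1 : (fun ω (r : Icc (0 : ℝ) s) => Real.exp (-driftPrimitive f r) •
      brownianIntegral f B 0 r ω) = fun ω => φ fun r => B r ω := by
    ext1 ω
    ext1 r
    refine congrArg (fun u => Real.exp (-driftPrimitive f r) • limUnder atTop u)
      (riemannSum_congr (a := 0) r.2.1 fun q hq => ?_)
    rw [sub_zero]
    exact congrArg (B · ω) (min_eq_left (Real.toNNReal_le_toNNReal (hq.2.trans r.2.2))).symm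
  have e2 : brownianIntegral f B s t
      = fun ω => ψ fun r => B (s.toNNReal + r) ω - B s.toNNReal ω := by
    ext1 ω
    refine congrArg (limUnder atTop) (riemannSum_congr (a := B s.toNNReal ω) hst fun q hq => ?_).symm
    beta_reduce
    rw [← Real.toNNReal_add hs (sub_nonneg.2 hq.1), add_sub_cancel]
    rfl
  rw [e1, e2]
  exact (hB.indepFun_shift s.toNNReal).symm.comp hφ hψ

/-! #### The law of the integral -/

/-- The sum is a combination of independent Gaussian increments; its variance is the Riemann sum of
`w²` for the same partition. -/
theorem charFun_map_riemannSum [IsProbabilityMeasure μ] {X : ℝ≥0 → Ω → ℝ}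
    (hX : IsPreBrownianReal X μ) (hs : 0 ≤ s) (hst : s ≤ t) (w : ℝ → ℝ) (k : ℕ) (ξ : ℝ) :
    charFun (μ.map fun ω => riemannSum w (fun r => X r.toNNReal ω) s t k) ξ
      = Complex.exp (-(riemannSum (fun r => w r ^ 2) (fun r : ℝ => r) s t k * ξ ^ 2 / 2 : ℝ)) := by
  set p : ℕ → ℝ := fun i => s + (t - s) * (i / k) with hp
  have hpm : Monotone p := monotone_nat_of_le_succ fun i => partition_mono hst i k
  have hp0 : ∀ i, 0 ≤ p i := fun i => by
    have : 0 ≤ (t - s) * (i / k : ℝ) := mul_nonneg (sub_nonneg.2 hst) (by positivity)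
    simp only [hp]
    linarith
  have hind : iIndepFun (fun i ω => w (p i) * (X (p (i + 1)).toNNReal ω - X (p i).toNNReal ω)) μ :=
    (hX.hasIndepIncrements.nat (t := fun i => (p i).toNNReal)
      fun i j hij => Real.toNNReal_le_toNNReal (hpm hij)).comp (fun i x => w (p i) * x)
        fun i => by fun_prop
  have hlaw : ∀ i, HasLaw (fun ω => w (p i) * (X (p (i + 1)).toNNReal ω - X (p i).toNNReal ω)) _ μ :=
    fun i => gaussianReal_const_mul (hX.hasLaw_sub _ _) (w (p i))
  have e : (fun ω => riemannSum w (fun r => X r.toNNReal ω) s t k) = fun ω =>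
      ∑ i ∈ Finset.range k, w (p i) * (X (p (i + 1)).toNNReal ω - X (p i).toNNReal ω) := rfl
  rw [e, (hind.restrict _).charFun_map_fun_finsetSum_eq_prod fun i _ => (hlaw i).aemeasurable,
    Finset.prod_apply]
  have hterm : ∀ i ∈ Finset.range k,
      charFun (μ.map fun ω => w (p i) * (X (p (i + 1)).toNNReal ω - X (p i).toNNReal ω)) ξ
      = Complex.exp ((-(w (p i) ^ 2 * (p (i + 1) - p i) * ξ ^ 2 / 2) : ℝ)) := fun i _ => by
    rw [(hlaw i).map_eq, charFun_gaussianReal]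
    have hd : ((nndist ((p (i + 1)).toNNReal : ℝ) ((p i).toNNReal : ℝ) : ℝ≥0) : ℝ)
        = p (i + 1) - p i := by
      rw [coe_nndist, Real.coe_toNNReal _ (hp0 _), Real.coe_toNNReal _ (hp0 _), Real.dist_eq,
        abs_of_nonneg (sub_nonneg.2 (hpm i.le_succ))]
    congr 1
    rw [← hd]
    push_cast
    simp
  rw [Finset.prod_congr rfl hterm, ← Complex.exp_sum, ← Complex.ofReal_sum]
  rw [← Complex.ofReal_neg, Finset.sum_neg_distrib, riemannSum, Finset.sum_mul, Finset.sum_div]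
  rfl

theorem IsBrownianMotion.charFun_map_riemannSum [IsProbabilityMeasure μ]
    (hB : IsBrownianMotion B μ) (hs : 0 ≤ s) (hst : s ≤ t) (w : ℝ → ℝ) (k : ℕ)
    (ξ : EuclideanSpace ℝ (Fin n)) :
    charFun (μ.map fun ω => riemannSum w (brownianPath B ω) s t k) ξ = Complex.exp
      (-(riemannSum (fun r => w r ^ 2) (fun r : ℝ => r) s t k * ‖ξ‖ ^ 2 / 2 : ℝ)) := by
  have hBi : ∀ i r, Measurable fun ω => B r ω i := fun i r => by
    have := hB.measurable r
    fun_prop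
  have hind : iIndepFun (fun (i : Fin n) ω => riemannSum w (fun r => B r.toNNReal ω i) s t k) μ :=
    hB.indep.comp (fun _ v => riemannSum w (fun r => v r.toNNReal) s t k)
      fun _ => measurable_riemannSum (b := fun (v : ℝ≥0 → ℝ) r => v r.toNNReal)
        (fun r => measurable_pi_apply _) w s t k
  have e : (fun ω => riemannSum w (brownianPath B ω) s t k) = fun ω =>
      WithLp.toLp 2 fun i => riemannSum w (fun r => B r.toNNReal ω i) s t k := by
    ext ω i
    simp [riemannSum, brownianPath]
  rw [e, (iIndepFun_iff_charFun_pi fun i =>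
    (measurable_riemannSum (fun r => hBi i _) w s t k).aemeasurable).1 hind ξ]
  simp_rw [_root_.charFun_map_riemannSum (hB.coord _).toIsPreBrownianReal hs hst]
  rw [← Complex.exp_sum, Finset.sum_neg_distrib, ← Complex.ofReal_sum, EuclideanSpace.real_norm_sq_eq, Finset.mul_sum, Finset.sum_div]

/-- The characteristic functions of the Riemann sums have two limits: that of the integral, by
dominated convergence, and the Gaussian one, by convergence of the variances. -/
theorem IsBrownianMotion.map_brownianIntegral [IsProbabilityMeasure μ]
    (hB : IsBrownianMotion B μ) (hf : IsDriftCoefficient f) (hs : s ∈ Ico (0 : ℝ) 1)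
    (ht : t ∈ Ico (0 : ℝ) 1) (hst : s ≤ t) :
    μ.map (brownianIntegral f B s t) = (stdGaussian (EuclideanSpace ℝ (Fin n))).map
      (√(driftClock f t - driftClock f s) • ·) := by
  have hI := hB.measurable_brownianIntegral f s t
  refine @Measure.ext_of_charFun _ _ _ _ _ _ _ _ _
    (Measure.isFiniteMeasure_map _ _) (Measure.isFiniteMeasure_map _ _) ?_
  ext ξ
  set W : ℝ → ℝ := fun r => Real.exp (driftPrimitive f r) with hW
  have hW2 : (fun r => W r ^ 2) = fun r => Real.exp (2 * driftPrimitive f r) := by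
    ext r
    rw [hW, ← Real.exp_nat_mul]
    rfl
  have hmeas : ∀ k, Measurable fun ω => riemannSum W (brownianPath B ω) s t k := fun k =>
    measurable_riemannSum (fun r => hB.measurable _) W s t k
  have hlim1 : Tendsto (fun k => charFun (μ.map fun ω => riemannSum W (brownianPath B ω) s t k) ξ)
      atTop (𝓝 (charFun (μ.map (brownianIntegral f B s t)) ξ)) := by
    simp_rw [charFun_apply]
    rw [integral_map hI.aemeasurable (Continuous.aestronglyMeasurable (by fun_prop))]
    have : ∀ k, ∫ x, Complex.exp (inner ℝ x ξ * Complex.I)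
        ∂(μ.map fun ω => riemannSum W (brownianPath B ω) s t k)
        = ∫ ω, Complex.exp (inner ℝ (riemannSum W (brownianPath B ω) s t k) ξ * Complex.I) ∂μ :=
      fun k => integral_map (hmeas k).aemeasurable (Continuous.aestronglyMeasurable (by fun_prop))
    simp_rw [this]
    refine tendsto_integral_of_dominated_convergence (fun _ => 1) (fun k => ?_)
      (integrable_const 1) (fun k => ae_of_all _ fun ω => (Complex.norm_exp_ofReal_mul_I _).le) ?_
    · exact ((by fun_prop : Continuous fun x : EuclideanSpace ℝ (Fin n) =>
        Complex.exp (inner ℝ x ξ * Complex.I)).measurable.comp (hmeas k)).aestronglyMeasurable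
    · filter_upwards [hB.ae_continuous] with ω hω
      rw [brownianIntegral_eq hf hs ht hst hω]
      exact ((by fun_prop : Continuous fun x : EuclideanSpace ℝ (Fin n) =>
        Complex.exp (inner ℝ x ξ * Complex.I)).tendsto _).comp
        (tendsto_riemannSum_pathIntegral hf hs ht hst hω.continuousOn)
  have hlim2 : Tendsto (fun k => charFun (μ.map fun ω => riemannSum W (brownianPath B ω) s t k) ξ)
      atTop (𝓝 (Complex.exp (-((driftClock f t - driftClock f s) * ‖ξ‖ ^ 2 / 2 : ℝ)))) := by
    simp_rw [hB.charFun_map_riemannSum hs.1 hst, hW2]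
    have h := (((tendsto_riemannSum_clock hf hs ht hst).mul_const (‖ξ‖ ^ 2)).div_const 2)
    exact ((Complex.continuous_exp.comp (Complex.continuous_ofReal.neg)).tendsto _).comp h
  rw [tendsto_nhds_unique hlim1 hlim2, charFun_map_smul, charFun_stdGaussian, norm_smul,
    Real.norm_of_nonneg (Real.sqrt_nonneg _), neg_div]
  congr 2
  rw [← Complex.ofReal_pow, mul_pow, Real.sq_sqrt (sub_nonneg.2 (hf.clock_mono hs ht hst))]
  push_cast
  ring

end BrownianIntegral

/-! ### Solutions of the stochastic differential equation -/

section Solutions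

variable {Ω : Type*} [MeasurableSpace Ω] {μ : Measure Ω} {n : ℕ}
  {B : ℝ≥0 → Ω → EuclideanSpace ℝ (Fin n)} {y y' : ℝ → Ω → EuclideanSpace ℝ (Fin n)} {f : ℝ → ℝ}

theorem exists_isSDESolution (hf : IsDriftCoefficient f) (hB : IsBrownianMotion B μ) :
    ∃ y, IsSDESolution f B y μ := by
  have h0 : (0 : ℝ) ∈ Ico (0 : ℝ) 1 := ⟨le_rfl, one_pos⟩
  have key : ∀ᵐ ω ∂μ, ∀ t ∈ Ico (0 : ℝ) 1,
      Real.exp (-driftPrimitive f t) • brownianIntegral f B 0 t ω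
        = pathSolution f (brownianPath B ω) t := by
    filter_upwards [hB.ae_continuous] with ω hω t ht
    rw [brownianIntegral_eq hf h0 ht ht.1 hω, pathSolution]
  -- The limit of Riemann sums serves as witness because its measurability in `ω` is already known;
  -- it agrees almost surely with `pathSolution` at all times.
  refine ⟨fun t ω => Real.exp (-driftPrimitive f t) • brownianIntegral f B 0 t ω,
    fun t _ => (hB.measurable_brownianIntegral f 0 t).const_smul
      (Real.exp (-driftPrimitive f t)), ?_, ?_, ?_⟩
  · filter_upwards [key, hB.ae_continuous] with ω h hω
    exact (continuousOn_pathSolution hf hω.continuousOn).congr h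
  · filter_upwards [key, hB.ae_zero] with ω h hω
    rw [h 0 h0, pathSolution_eq hω, hω]
    simp
  · filter_upwards [key, hB.ae_zero, hB.ae_continuous] with ω h h0' hω t ht
    rw [h t ht, pathSolution_equation hf hω.continuousOn h0' ht]
    refine congrArg (brownianPath B ω t - ·) (intervalIntegral.integral_congr fun r hr => ?_)
    simp only [h r (uIcc_subset_Ico_zero_one h0 ht hr)]

theorem IsSDESolution.ae_eq (hf : IsDriftCoefficient f) (hy : IsSDESolution f B y μ)
    (hy' : IsSDESolution f B y' μ) : ∀ᵐ ω ∂μ, ∀ t ∈ Ico (0 : ℝ) 1, y t ω = y' t ω := by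
  filter_upwards [hy.continuousOn, hy'.continuousOn, hy.equation, hy'.equation]
    with ω h1 h2 h3 h4 t ht
  exact eq_of_equation (b := brownianPath B ω) hf h1 h2 h3 h4 ht

theorem IsSDESolution.ae_eq_pathSolution (hf : IsDriftCoefficient f) (hB : IsBrownianMotion B μ)
    (hy : IsSDESolution f B y μ) :
    ∀ᵐ ω ∂μ, ∀ t ∈ Ico (0 : ℝ) 1, y t ω = pathSolution f (brownianPath B ω) t := by
  filter_upwards [hy.continuousOn, hy.equation, hB.ae_continuous, hB.ae_zero]
    with ω h1 h2 h3 h4 t ht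
  exact eq_of_equation (b := brownianPath B ω) hf h1 (continuousOn_pathSolution hf h3.continuousOn)
    h2 (fun r hr => pathSolution_equation hf h3.continuousOn h4 hr) ht

theorem bridgeKernel_eq_map [IsProbabilityMeasure μ] (hf : IsDriftCoefficient f)
    (hB : IsBrownianMotion B μ) {s t : ℝ} (hs : s ∈ Ico (0 : ℝ) 1) (ht : t ∈ Ico (0 : ℝ) 1)
    (hst : s ≤ t) (x : EuclideanSpace ℝ (Fin n)) :
    bridgeKernel (EuclideanSpace ℝ (Fin n)) f s t x = (μ.map (brownianIntegral f B s t)).map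
      fun z => transitionScale f s t • x + Real.exp (-driftPrimitive f t) • z := by
  rw [bridgeKernel_apply, hB.map_brownianIntegral hf hs ht hst,
    Measure.map_map (by fun_prop) (by fun_prop)]
  congr 1
  ext1 z
  simp only [Function.comp_apply, transitionNoise, smul_smul]

theorem IsSDESolution.isMarkovProcess [IsProbabilityMeasure μ] (hf : IsDriftCoefficient f)
    (hB : IsBrownianMotion B μ) (hy : IsSDESolution f B y μ) :
    IsMarkovProcess (bridgeKernel (EuclideanSpace ℝ (Fin n)) f) y μ := by
  have h0 : (0 : ℝ) ∈ Ico (0 : ℝ) 1 := ⟨le_rfl, one_pos⟩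
  refine ⟨isTransitionFamily_bridgeKernel hf, hy.measurable, fun s t hs0 hst ht1 A hA => ?_⟩
  have hs : s ∈ Ico (0 : ℝ) 1 := ⟨hs0, hst.trans_lt ht1⟩
  have ht : t ∈ Ico (0 : ℝ) 1 := ⟨hs0.trans hst, ht1⟩
  have hmeas : ∀ r ∈ Icc (0 : ℝ) s, Measurable (y r) := fun r hr =>
    hy.measurable r ⟨hr.1, hr.2.trans_lt hs.2⟩
  refine condExp_indicator_of_indep (history_le hmeas) (measurable_history y hs0)
    (hB.measurable_brownianIntegral f s t) (hy.measurable t ht)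
    (g := fun p => transitionScale f s t • p.1 + Real.exp (-driftPrimitive f t) • p.2)
    (by fun_prop) ?_ ?_ (bridgeKernel_eq_map hf hB hs ht hst) hA
  · filter_upwards [hy.ae_eq_pathSolution hf hB, hB.ae_continuous] with ω h hω
    rw [h t ht, h s hs, pathSolution_eq_add hf hω.continuousOn hs ht,
      brownianIntegral_eq hf hs ht hst hω, transitionScale]
  -- Outside one null set `y` agrees with the explicit solution at all times in `[0, s]`, so
  -- independence transfers to the history of `y` without completing the filtration.
  · rw [history_eq_comap]
    refine (hB.indepFun_brownianIntegral f hs0 hst).congr ?_ (EventuallyEq.refl _ _)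
    filter_upwards [hy.ae_eq_pathSolution hf hB, hB.ae_continuous] with ω h hω
    ext1 r
    have hr : (r : ℝ) ∈ Ico (0 : ℝ) 1 := ⟨r.2.1, r.2.2.trans_lt hs.2⟩
    rw [h r hr, brownianIntegral_eq hf h0 hr hr.1 hω, pathSolution]

theorem IsSDESolution.isMarkovWithDrift [IsProbabilityMeasure μ] (hf : IsDriftCoefficient f)
    (hB : IsBrownianMotion B μ) (hy : IsSDESolution f B y μ) : IsMarkovWithDrift f 0 y μ :=
  ⟨_, hy.isMarkovProcess hf hB, hasBridgeGenerator_bridgeKernel hf⟩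

/-- This lets the value at time `1` be prescribed without affecting the Markov property on `[0,1)`.
-/
theorem IsMarkovProcess.congr {E : Type*} [MeasurableSpace E] {κ : ℝ → ℝ → Kernel E E}
    {z z' : ℝ → Ω → E} (hz : IsMarkovProcess κ z μ) (h : ∀ t ∈ Ico (0 : ℝ) 1, z' t = z t) :
    IsMarkovProcess κ z' μ := by
  refine ⟨hz.isTransitionFamily, fun t ht => h t ht ▸ hz.measurable t ht,
    fun s t hs hst ht A hA => ?_⟩
  rw [h t ⟨hs.trans hst, ht⟩, h s ⟨hs, hst.trans_lt ht⟩,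
    history_congr fun r hr => h r ⟨hr.1, hr.2.trans_lt (hst.trans_lt ht)⟩]
  exact hz.markov s t hs hst ht A hA

theorem IsSDESolution.tendsto_zero (hf : IsDriftCoefficient f)
    (hlim : Tendsto (driftPrimitive f) (𝓝[<] 1) atTop) (hpos : ∀ᶠ t in 𝓝[<] (1 : ℝ), 0 ≤ f t)
    (hB : IsBrownianMotion B μ) (hy : IsSDESolution f B y μ) :
    ∀ᵐ ω ∂μ, Tendsto (fun t => y t ω) (𝓝[<] 1) (𝓝 0) := by
  filter_upwards [hy.ae_eq_pathSolution hf hB, hB.ae_continuous, hB.ae_zero] with ω h h1 h2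
  refine (tendsto_pathSolution hf hlim hpos h1.continuousOn h2).congr' ?_
  filter_upwards [Ico_mem_nhdsLT_one] with t ht
  exact (h t ht).symm

theorem continuousOn_update_Icc {E : Type*} [TopologicalSpace E] {z : ℝ → E} {a : E}
    (hz : ContinuousOn z (Ico 0 1)) (h : Tendsto z (𝓝[<] 1) (𝓝 a)) :
    ContinuousOn (Function.update z 1 a) (Icc 0 1) := by
  rw [continuousOn_update_iff, Icc_sdiff_right]
  exact ⟨hz, fun _ => h.mono_left (nhdsWithin_mono _ fun _ hx => hx.2)⟩

theorem IsSDESolution.isBridgeWithDrift [IsProbabilityMeasure μ] (hf : IsDriftCoefficient f)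
    (hlim : Tendsto (driftPrimitive f) (𝓝[<] 1) atTop) (hpos : ∀ᶠ t in 𝓝[<] (1 : ℝ), 0 ≤ f t)
    (hB : IsBrownianMotion B μ) (hy : IsSDESolution f B y μ) :
    IsBridgeWithDrift f 0 0 (Function.update y 1 0) μ := by
  have hupd : ∀ t ∈ Ico (0 : ℝ) 1, Function.update y 1 0 t = y t := fun t ht =>
    Function.update_of_ne ht.2.ne _ _
  have happ : ∀ ω, (fun t => Function.update y 1 0 t ω)
      = Function.update (fun t => y t ω) 1 0 := fun ω => by
    ext1 t
    rcases eq_or_ne t 1 with rfl | ht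
    · simp
    · rw [Function.update_of_ne ht, Function.update_of_ne ht]
  have hlim0 := hy.tendsto_zero hf hlim hpos hB
  refine ⟨fun t ht => ?_, ?_, ?_, ?_, ?_⟩
  · rcases eq_or_ne t 1 with rfl | h
    · rw [Function.update_self]
      exact measurable_zero
    · have ht' : t ∈ Ico (0 : ℝ) 1 := ⟨ht.1, lt_of_le_of_ne ht.2 h⟩
      rw [hupd t ht']
      exact hy.measurable t ht'
  · filter_upwards [hy.continuousOn, hlim0] with ω h1 h2
    rw [happ]
    exact continuousOn_update_Icc h1 h2
  · rw [hupd 0 ⟨le_rfl, one_pos⟩]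
    exact hy.initial
  · exact ⟨_, (hy.isMarkovProcess hf hB).congr hupd, hasBridgeGenerator_bridgeKernel hf⟩
  · filter_upwards [hlim0] with ω h
    refine h.congr' ?_
    filter_upwards [Ico_mem_nhdsLT_one] with t ht
    rw [hupd t ht]

end Solutions

theorem mainTheorem4 (n : ℕ) (f : ℝ → ℝ)
    (hf_int : ∀ t₀ ∈ Ioo (0 : ℝ) 1, IntervalIntegrable f volume 0 t₀)
    (hf_lim : Tendsto (fun t => ∫ s in (0 : ℝ)..t, f s) (𝓝[<] 1) atTop) :
    -- the kernel `G_f`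
    HasApproxIdentityLimits (driftKernel f) ∧
    ((∀ s ∈ Ico (0 : ℝ) 1, 0 ≤ f s) → IsApproxIdentity (driftKernel f)) ∧
    -- the stochastic differential equation
    ∀ (Ω : Type*) [MeasurableSpace Ω] (μ : Measure Ω) [IsProbabilityMeasure μ]
      (B : ℝ≥0 → Ω → EuclideanSpace ℝ (Fin n)), IsBrownianMotion B μ →
      (∃ y, IsSDESolution f B y μ) ∧
      (∀ y y', IsSDESolution f B y μ → IsSDESolution f B y' μ →
        ∀ᵐ ω ∂μ, ∀ t ∈ Ico (0 : ℝ) 1, y t ω = y' t ω) ∧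
      (∀ y, IsSDESolution f B y μ →
        IsMarkovWithDrift f 0 y μ ∧
        ((∀ᶠ t in 𝓝[<] (1 : ℝ), 0 ≤ f t) →
          (∀ᵐ ω ∂μ, Tendsto (fun t => y t ω) (𝓝[<] 1) (𝓝 0)) ∧
          IsBridgeWithDrift f 0 0 (Function.update y 1 0) μ) ∧
        (Tendsto f (𝓝[<] 1) atTop →
          IsGeneralisedBrownianBridge 0 0 (Function.update y 1 0) μ)) := by
  have hf : IsDriftCoefficient f := hf_int
  refine ⟨hasApproxIdentityLimits_driftKernel hf hf_lim, isApproxIdentity_driftKernel hf hf_lim,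
    fun Ω _ μ _ B hB => ⟨exists_isSDESolution hf hB, fun y y' hy hy' => hy.ae_eq hf hy',
      fun y hy => ⟨hy.isMarkovWithDrift hf hB, fun hpos => ⟨hy.tendsto_zero hf hf_lim hpos hB,
        hy.isBridgeWithDrift hf hf_lim hpos hB⟩, fun htop => ?_⟩⟩⟩
  -- Divergence of `f` to infinity makes it nonnegative near `1`, as required for the limit of `y`.
  exact ⟨f, hf, htop, hy.isBridgeWithDrift hf hf_lim (htop.eventually_ge_atTop 0) hB⟩
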